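/- For integers $m,q\ge 1$ put $$G_m(q)=\max_{\substack{a\in\mathbb Z\\ \gcd(a,q)=1}}\Bigl|\sum_{x=0}^{q-1}e^{2\pi i a x^m/q}\Bigr| .$$ For $k\ge 1$ let $\gamma_k$ be the $k$-th Hermite constant, i.e. the maximum, over all real positive definite $k\times k$ matrices $A$, of $\det(A)^{-1/k}\min_{z\in\mathbb Z^k\setminus\{0\}} z^{T}Az$. Let $\varphi$ be the Euler function, let $\lambda=2\cdot 3^{-1/4}$, and for an integer $r\ge 2$ put $$C_r=\bigl(r\,\gamma_{r-1}^{\,r-1}\bigr)^{-1/r},\qquad K_r=4\Bigl(1-\frac1{f_r}\Bigr)C_r,$$ where $f_r$ is the least natural number such that $\varphi(f_r)\ge r$. **Proposition.** Let $n\ge 1$ be an integer, let $p$ be a prime, and put $d=\gcd(n,p-1)$ and $t=(p-1)/d$. Let $r$ be an integer with $\varphi(t)\ge r\ge 2$, and suppose that the inequalities $$p^{2/r}\,t^{1-1/r}>32\,r\,C_r$$ and $$p^{1-1/n}\ \ge\ 1+\lambda\left(\frac{p^{5}\log p}{2K_r\,(p-1)^{1/r}}\right)^{3r/(16r-8)}$$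 hold. Then $G_d(p)\le p^{1-1/n}$. -/

import Mathlib

/-- The Gauss sum `S_n(a, q) = ∑_{x mod q} e(a x ^ n / q)`, where `e(u) = exp(2 π i u)`. -/
noncomputable def gaussS (n : ℕ) (a : ℤ) (q : ℕ) : ℂ :=
  ∑ x ∈ Finset.range q,
    Complex.exp (2 * (Real.pi : ℂ) * Complex.I * ((a : ℂ) * (x : ℂ) ^ n / (q : ℂ)))

/-- `G_n(q)`, the maximum of `|S_n(a, q)|` over the integers `a` coprime to `q`. The sum depends
only on `a` modulo `q`, so the supremum is over a finite set of values when `q ≥ 1`. -/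
noncomputable def gaussG (n q : ℕ) : ℝ :=
  sSup {v : ℝ | ∃ a : ℤ, Int.gcd a (q : ℤ) = 1 ∧ v = ‖gaussS n a q‖}

/-- The minimum of the quadratic form `z ↦ zᵀ A z` over the nonzero integer vectors `z`.
If `A` is the Gram matrix of a basis of a lattice, this is the squared length of a shortest
nonzero lattice vector. -/
noncomputable def latticeMin {k : ℕ} (A : Matrix (Fin k) (Fin k) ℝ) : ℝ :=
  sInf {v : ℝ | ∃ z : Fin k → ℤ, z ≠ 0 ∧
    v = (fun i => (z i : ℝ)) ⬝ᵥ (A.mulVec (fun i => (z i : ℝ)))}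

/-- The `k`-th Hermite constant `γ_k` (for `k ≥ 1`): the maximum of `min(A) / det(A) ^ (1 / k)`
over all real positive definite `k × k` matrices `A`. These are exactly the Gram matrices of
bases of full lattices `L` in `ℝ ^ k`, and `det(A)` is the squared covolume of `L`. -/
noncomputable def hermiteConst (k : ℕ) : ℝ :=
  sSup {v : ℝ | ∃ A : Matrix (Fin k) (Fin k) ℝ, A.PosDef ∧
    v = latticeMin A / A.det ^ (1 / (k : ℝ))}

/-- `C_r = (r γ_{r-1} ^ (r-1)) ^ (-1/r)`, for `r ≥ 2`. -/
noncomputable def constC (r : ℕ) : ℝ :=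
  ((r : ℝ) * hermiteConst (r - 1) ^ (r - 1)) ^ (-(1 / (r : ℝ)))

/-- `f_r`, the least natural number whose Euler totient is at least `r`. -/
noncomputable def leastTotient (r : ℕ) : ℕ :=
  sInf {f : ℕ | r ≤ Nat.totient f}

/-- `K_r = 4 (1 - 1 / f_r) C_r`, for `r ≥ 2`. -/
noncomputable def constK (r : ℕ) : ℝ :=
  4 * (1 - 1 / (leastTotient r : ℝ)) * constC r

/-- The constant `λ = 2 * 3 ^ (-1/4)`. -/
noncomputable def constLambda : ℝ :=
  2 * (3 : ℝ) ^ (-(1 / 4 : ℝ))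

/-! Since `d * t = p - 1`, the map x ↦ x^d on nonzero residues is d-to-one onto the group H of t-th
roots of unity mod p. Hence the Gauss sum is 1 + d s(a), with s(a) the sum of e(ah/p) over h in H.
Suppose 1 + d|s| > p^(1-1/n); two bounds for |s| of different origin then collide.

Geometry of numbers keeps |s| away from t. Put Δ(b) = ∑_h (1 - cos(2πbh/p)); then t² - |s(a)|² is
the sum of Δ(a(k-1)) over k in H. If Δ(b) is small, some window w of r consecutive least residues of
b g^j (g a generator of H) is short. An integer vector z ≠ 0 orthogonal to w gives ∑ z_i g^i = 0 mod
p, so its product with every window is a multiple of p. These products do not all vanish, because r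
≤ φ(t) and the cyclotomic polynomial Φ_t is irreducible; hence |z|² ≥ 8/Δ. The lattice orthogonal to
w has rank r - 1 and covolume at most |w|, so Hermite's constant bounds Δ below
(`le_deficiency_pow`, `le_deficiency`). As p^(1-1/n) ≥ p - (p log p)/d, the resulting bound for t -
|s| makes d small: p^(4-2/r) d^(2-1/r) 2^(1/r-1) ≤ Z, where Z is the base of the power in the second
hypothesis.

Stepanov's method bounds the additive energy E of H by √10 t^(5/2) when 10 t^5 < p^3
(`energy_sq_le`), and moments give |s|^8 ≤ p E². Together with the square-root bound outside that
range, (d|s|)^8 ≤ 10 p^6 d^3. The bound on d turns the right side into less than λ^8 times the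
eighth power of Z^(3r/(16r-8)), because λ^8 2^(-3/2) > 10. This contradicts the second hypothesis.
-/

open Polynomial

/-! ### Stepanov's method: points with x^t = (x-1)^t = v. -/

/-- The operator X·d/dX - e₀ kills the monomial of exponent e₀, rescales the others by nonzero
factors, and lowers the order of vanishing at 1 by at most one; induction on the number of terms
follows. -/
theorem sparse_polynomial_eq_zero {K : Type*} [Field K] (s : Finset ℕ) :
    ∀ c : ℕ → K, Set.InjOn (fun e : ℕ => (e : K)) s →
      (X - 1 : K[X]) ^ s.card ∣ ∑ e ∈ s, C (c e) * X ^ e → ∀ e ∈ s, c e = 0 := by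
  induction s using Finset.induction_on with
  | empty => simp
  | insert e₀ s he ih =>
    intro c hinj hdvd
    rw [Finset.card_insert_of_notMem he] at hdvd
    set P := ∑ e ∈ insert e₀ s, C (c e) * X ^ e with hP
    have hder : (X - 1 : K[X]) ^ s.card ∣ derivative P := by
      simpa using pow_sub_one_dvd_derivative_of_pow_dvd hdvd
    have hP' : (X - 1 : K[X]) ^ s.card ∣ P := (pow_dvd_pow _ (Nat.le_succ _)).trans hdvd
    have hQ : X * derivative P - C (e₀ : K) * P =
        ∑ e ∈ s, C (((e : K) - e₀) * c e) * X ^ e := by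
      rw [hP, derivative_sum, Finset.mul_sum, Finset.mul_sum, ← Finset.sum_sub_distrib,
        Finset.sum_insert he]
      have key : ∀ e : ℕ, X * derivative (C (c e) * X ^ e) - C (e₀ : K) * (C (c e) * X ^ e) =
          C (((e : K) - e₀) * c e) * X ^ e := by
        intro e
        rw [derivative_C_mul_X_pow]
        rcases e with _ | e
        · simp
        · simp only [Nat.add_sub_cancel, map_mul, map_sub, pow_succ]
          ring
      simp only [key]
      simp
    have hz : ∀ e ∈ s, ((e : K) - e₀) * c e = 0 := by
      refine ih (fun e => ((e : K) - e₀) * c e) (hinj.mono (by simp)) ?_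
      rw [← hQ]
      exact dvd_sub (hder.mul_left _) (hP'.mul_left _)
    have hs : ∀ e ∈ s, c e = 0 := by
      intro e hes
      rcases mul_eq_zero.1 (hz e hes) with h | h
      · exfalso
        have := hinj (by simp [hes]) (by simp) (sub_eq_zero.1 h)
        exact he (this ▸ hes)
      · exact h
    intro e hes
    rcases Finset.mem_insert.1 hes with rfl | hes
    · have h1 : P.eval 1 = 0 := by
        obtain ⟨q, hq⟩ := hdvd
        rw [hq]; simp
      rw [hP, Finset.sum_insert he, Finset.sum_eq_zero (fun x hx => by rw [hs x hx]; simp)] at h1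
      simpa using h1
    · exact hs e hes

/-- The polynomial `Q_m` with `(X(X-1))^m (Q X^n (X-1)^k)^{(m)} = Q_m X^n (X-1)^k`. -/
noncomputable def derivFactor {K : Type*} [Field K] (n k : ℕ) (Q : K[X]) : ℕ → K[X]
  | 0 => Q
  | m + 1 => X * (X - 1) * derivative (derivFactor n k Q m) +
      (C (n : K) * (X - 1) + C (k : K) * X - C (m : K) * (2 * X - 1)) * derivFactor n k Q m

/-- The factors X^n and (X-1)^k survive differentiation once X(X-1) is multiplied in. On a fibre
they become powers of v, so vanishing reduces to conditions on the low-degree factor `derivFactor`.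
-/
theorem iterate_derivative_mul_pow {K : Type*} [Field K] (n k : ℕ) (Q : K[X]) (m : ℕ) :
    (X * (X - 1)) ^ m * derivative^[m] (Q * X ^ n * (X - 1) ^ k) =
      derivFactor n k Q m * X ^ n * (X - 1) ^ k := by
  induction m with
  | zero => simp [derivFactor]
  | succ m ih =>
    have h := congrArg (fun P => X * (X - 1) * derivative P) ih
    simp only [derivative_mul, derivative_pow, derivative_X, derivative_sub, derivative_one,
      mul_one, sub_zero, one_mul] at h
    rw [Function.iterate_succ_apply']
    set G := derivative^[m] (Q * X ^ n * (X - 1) ^ k)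
    set q := derivFactor n k Q m with hq
    -- Multiplying back by X makes the identity valid at n = 0 as well, where `n - 1` truncates;
    -- likewise for `e2` and `e3`.
    have e1 : (X : K[X]) * (C (n : K) * X ^ (n - 1)) = C (n : K) * X ^ n := by
      rcases n with _ | n
      · simp
      · simp only [Nat.add_sub_cancel, pow_succ]; ring
    have e2 : (X - 1 : K[X]) * (C (k : K) * (X - 1) ^ (k - 1)) = C (k : K) * (X - 1) ^ k := by
      rcases k with _ | k
      · simp
      · simp only [Nat.add_sub_cancel, pow_succ]; ring
    have e3 : (X * (X - 1) : K[X]) * (C (m : K) * (X * (X - 1)) ^ (m - 1)) =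
        C (m : K) * (X * (X - 1)) ^ m := by
      rcases m with _ | m
      · simp
      · simp only [Nat.add_sub_cancel, pow_succ]; ring
    simp only [derivFactor, ← hq]
    rw [pow_succ]
    linear_combination h + (X - 1) * q * (X - 1) ^ k * e1 + X * q * X ^ n * e2
      - (2 * X - 1) * G * e3 - C (m : K) * (2 * X - 1) * ih

/-- The degree grows by at most one per derivative, so for Q = X^a with a < A the m-th condition
costs only A + m linear equations. -/
theorem natDegree_derivFactor_le {K : Type*} [Field K] (n k : ℕ) (Q : K[X]) (m : ℕ) :
    (derivFactor n k Q m).natDegree ≤ Q.natDegree + m := by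
  induction m with
  | zero => simp [derivFactor]
  | succ m ih =>
    simp only [derivFactor]
    refine natDegree_add_le_of_degree_le ?_ ?_
    · by_cases hc : (derivFactor n k Q m).natDegree = 0
      · rw [natDegree_eq_zero.1 hc |>.choose_spec.symm]; simp
      have h1 : (X * (X - 1) : K[X]).natDegree ≤ 2 := by compute_degree
      have h2 := natDegree_derivative_lt hc
      refine natDegree_mul_le.trans ?_
      omega
    · have h1 : (C (n : K) * (X - 1) + C (k : K) * X - C (m : K) * (2 * X - 1)).natDegree ≤ 1 := by
        compute_degree
      refine natDegree_mul_le.trans ?_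
      omega

theorem iterate_derivative_finsetSum {K ι : Type*} [Field K] (s : Finset ι) (f : ι → K[X]) (m : ℕ) :
    derivative^[m] (∑ i ∈ s, f i) = ∑ i ∈ s, derivative^[m] (f i) := by
  induction m with
  | zero => simp
  | succ m ih => simp only [Function.iterate_succ_apply', ih, derivative_sum]

/-- Points of `x ↦ (x, x - 1)` lying over the pair of `t`-th powers `(v, v)`. -/
noncomputable def fibre (p t : ℕ) [NeZero p] (v : ZMod p) : Finset (ZMod p) :=
  Finset.univ.filter fun x => x ^ t = v ∧ (x - 1) ^ t = v

/-- The index set `b < B`, `b + c < D` of exponents. -/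
def trapezoid (B D : ℕ) : Finset (ℕ × ℕ) :=
  (Finset.range B ×ˢ Finset.range D).filter fun q => q.1 + q.2 < D

theorem card_trapezoid (B D : ℕ) : (trapezoid B D).card = ∑ b ∈ Finset.range B, (D - b) := by
  rw [trapezoid, Finset.card_filter, Finset.sum_product]
  refine Finset.sum_congr rfl fun b _ => ?_
  rw [← Finset.card_filter]
  have : (Finset.range D).filter (fun c => b + c < D) = Finset.range (D - b) := by
    ext c; simp; omega
  rw [this, Finset.card_range]

/-- The auxiliary polynomial with coefficients `l (a, b, c)`. -/
noncomputable def stepanovPoly {K : Type*} [Field K] (t : ℕ) (I : Finset (ℕ × ℕ × ℕ))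
    (l : ℕ × ℕ × ℕ → K) : K[X] :=
  ∑ q ∈ I, C (l q) * (X ^ q.1 * X ^ (t * q.2.1) * (X - 1) ^ (t * q.2.2))

/-- After removal of (X-1)^(t c₀), with c₀ least, the terms with c = c₀ form a polynomial in X with
at most AB ≤ t distinct exponents a + tb < p. The remaining terms are divisible by (X-1)^t, so if
everything cancelled this sparse polynomial would be too, which `sparse_polynomial_eq_zero` forbids.
-/
theorem stepanovPoly_ne_zero {p : ℕ} [Fact p.Prime] {t A B D : ℕ} (hAB : A * B ≤ t) (hB : 0 < B)
    (hp : A - 1 + t * (B - 1) < p) (l : ℕ × ℕ × ℕ → ZMod p)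
    (hl : ∃ q ∈ Finset.range A ×ˢ trapezoid B D, l q ≠ 0) :
    stepanovPoly t (Finset.range A ×ˢ trapezoid B D) l ≠ 0 := by
  classical
  intro h0
  set I := Finset.range A ×ˢ trapezoid B D with hI
  have hIm : ∀ a b c, (a, b, c) ∈ I ↔ a < A ∧ b < B ∧ c < D ∧ b + c < D := by
    intro a b c; simp [hI, trapezoid]; tauto
  have hAt : A ≤ t := (Nat.le_mul_of_pos_right A hB).trans hAB
  -- the least `c` carrying a nonzero coefficient
  have hex : ∃ c, ∃ a b, (a, b, c) ∈ I ∧ l (a, b, c) ≠ 0 := by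
    obtain ⟨⟨a, b, c⟩, h1, h2⟩ := hl; exact ⟨c, a, b, h1, h2⟩
  obtain ⟨a₀, b₀, hmem, hne⟩ := Nat.find_spec hex
  set c₀ := Nat.find hex with hc₀
  have hmin : ∀ a b c, (a, b, c) ∈ I → l (a, b, c) ≠ 0 → c₀ ≤ c := fun a b c h1 h2 =>
    Nat.find_min' hex ⟨a, b, h1, h2⟩
  let R := Finset.range A ×ˢ Finset.range B
  let e : ℕ × ℕ → ℕ := fun q => q.1 + t * q.2
  let l' : ℕ × ℕ → ZMod p := fun q => if (q.1, q.2, c₀) ∈ I then l (q.1, q.2, c₀) else 0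
  have heinj : Set.InjOn e R := by
    rintro ⟨a, b⟩ hab ⟨a', b'⟩ hab' h
    simp only [R, Finset.coe_product, Finset.coe_range, Set.mem_prod, Set.mem_Iio] at hab hab'
    simp only [e] at h
    have ha : a = a' := by
      have := congrArg (· % t) h
      simpa [Nat.add_mul_mod_self_left, Nat.mod_eq_of_lt (hab.1.trans_le hAt),
        Nat.mod_eq_of_lt (hab'.1.trans_le hAt)] using this
    subst ha
    have hb : t * b = t * b' := by omega
    have ht : 0 < t := lt_of_lt_of_le (by omega) hAt
    rw [Nat.eq_of_mul_eq_mul_left ht hb]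
  have helt : ∀ q ∈ R, e q < p := by
    rintro ⟨a, b⟩ hab
    simp only [R, Finset.mem_product, Finset.mem_range] at hab
    have : t * b ≤ t * (B - 1) := Nat.mul_le_mul_left _ (by omega)
    simp only [e]; omega
  -- the inner polynomial attached to `c₀` is divisible by `(X - 1) ^ t`
  have hdvd : (X - 1 : (ZMod p)[X]) ^ t ∣ ∑ q ∈ R, C (l' q) * X ^ e q := by
    have h1 : (X - 1 : (ZMod p)[X]) ^ (t * (c₀ + 1)) ∣
        (X - 1) ^ (t * c₀) * ∑ q ∈ R, C (l' q) * X ^ e q := by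
      have h2 : stepanovPoly t I l = (X - 1) ^ (t * c₀) * ∑ q ∈ R, C (l' q) * X ^ e q +
          ∑ q ∈ I.filter (fun q => q.2.2 ≠ c₀),
            C (l q) * (X ^ q.1 * X ^ (t * q.2.1) * (X - 1) ^ (t * q.2.2)) := by
        rw [stepanovPoly, ← Finset.sum_filter_add_sum_filter_not I (fun q => q.2.2 = c₀)]
        congr 1
        rw [Finset.mul_sum]
        have h3 : ∀ q ∈ R, q ∉ R.filter (fun q => (q.1, q.2, c₀) ∈ I) →
            (X - 1) ^ (t * c₀) * (C (l' q) * X ^ e q) = 0 := by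
          intro q hq hq'
          have : (q.1, q.2, c₀) ∉ I := fun h => hq' (Finset.mem_filter.2 ⟨hq, h⟩)
          simp [l', this]
        rw [← Finset.sum_subset (Finset.filter_subset _ R) h3]
        refine Finset.sum_bij' (fun q _ => (q.1, q.2.1)) (fun q _ => (q.1, q.2, c₀)) ?_ ?_ ?_ ?_ ?_
        · rintro ⟨a, b, c⟩ h
          simp only [Finset.mem_filter, hIm] at h
          obtain ⟨h, rfl⟩ := h
          simp only [Finset.mem_filter, hIm, R, Finset.mem_product, Finset.mem_range]
          tauto
        · rintro ⟨a, b⟩ h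
          simp only [Finset.mem_filter] at h ⊢
          exact ⟨h.2, trivial⟩
        · rintro ⟨a, b, c⟩ h
          simp only [Finset.mem_filter] at h
          simp [h.2]
        · rintro ⟨a, b⟩ h; rfl
        · rintro ⟨a, b, c⟩ h
          simp only [Finset.mem_filter] at h
          obtain ⟨h, rfl⟩ := h
          simp only [l', h, if_true, e, pow_add]
          ring
      have h4 : (X - 1 : (ZMod p)[X]) ^ (t * (c₀ + 1)) ∣
          ∑ q ∈ I.filter (fun q => q.2.2 ≠ c₀),
            C (l q) * (X ^ q.1 * X ^ (t * q.2.1) * (X - 1) ^ (t * q.2.2)) := by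
        refine Finset.dvd_sum ?_
        rintro ⟨a, b, c⟩ h
        simp only [Finset.mem_filter] at h
        by_cases hz : l (a, b, c) = 0
        · simp [hz]
        · have := hmin a b c h.1 hz
          have h5 : c₀ + 1 ≤ c := by
            rcases Nat.lt_or_eq_of_le this with h6 | h6
            · exact h6
            · exact absurd h6.symm h.2
          exact ((pow_dvd_pow _ (Nat.mul_le_mul_left t h5)).mul_left _).mul_left _
      rw [h0] at h2
      exact (dvd_add_left h4).1 (h2 ▸ dvd_zero _)
    rw [mul_add, mul_one, pow_add] at h1
    exact (mul_dvd_mul_iff_left (pow_ne_zero _ (X_sub_C_ne_zero (1 : ZMod p)))).1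
      (by simpa using h1)
  have hcard : (R.image e).card = A * B := by
    rw [Finset.card_image_of_injOn heinj]; simp [R]
  let l'' : ℕ → ZMod p := fun n => ∑ q ∈ R.filter (fun q => e q = n), l' q
  have hl'' : ∀ q ∈ R, l'' (e q) = l' q := by
    intro q hq
    have : R.filter (fun q' => e q' = e q) = {q} := by
      ext q'
      simp only [Finset.mem_filter, Finset.mem_singleton]
      exact ⟨fun h => heinj h.1 hq h.2, fun h => by subst h; exact ⟨hq, rfl⟩⟩
    simp [l'', this]
  have hsum : ∑ n ∈ R.image e, C (l'' n) * X ^ n = ∑ q ∈ R, C (l' q) * X ^ e q := by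
    rw [Finset.sum_image heinj]
    exact Finset.sum_congr rfl fun q hq => by rw [hl'' q hq]
  have hq₀ : (a₀, b₀) ∈ R := by
    have := (hIm _ _ _).1 hmem
    simp [R, this.1, this.2.1]
  have := sparse_polynomial_eq_zero (R.image e) l'' ?_ ?_ (e (a₀, b₀))
    (Finset.mem_image_of_mem e hq₀)
  · rw [hl'' _ hq₀] at this
    simp only [l', hmem, if_true] at this
    exact hne this
  · intro x hx y hy hxy
    simp only [Finset.coe_image, Set.mem_image, Finset.mem_coe] at hx hy
    obtain ⟨q, hq, rfl⟩ := hx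
    obtain ⟨q', hq', rfl⟩ := hy
    have := (ZMod.natCast_eq_natCast_iff' _ _ _).1 hxy
    rwa [Nat.mod_eq_of_lt (helt q hq), Nat.mod_eq_of_lt (helt q' hq')] at this
  · rw [hsum, hcard]
    exact (pow_dvd_pow _ hAB).trans hdvd

theorem natDegree_stepanovPoly_le {K : Type*} [Field K] {t A B D : ℕ} (hA : 0 < A)
    (l : ℕ × ℕ × ℕ → K) :
    (stepanovPoly t (Finset.range A ×ˢ trapezoid B D) l).natDegree ≤ A - 1 + t * (D - 1) := by
  refine natDegree_sum_le_of_forall_le _ _ ?_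
  rintro ⟨a, b, c⟩ h
  simp only [Finset.mem_product, Finset.mem_range, trapezoid, Finset.mem_filter] at h
  have h1 : (X ^ a * X ^ (t * b) * (X - 1) ^ (t * c) : K[X]).natDegree ≤
      a + t * b + t * c * 1 := by
    refine natDegree_mul_le_of_le (natDegree_mul_le_of_le (by simp) (by simp)) ?_
    exact natDegree_pow_le_of_le _ (by compute_degree)
  refine (natDegree_C_mul_le _ _).trans (h1.trans ?_)
  have : t * (b + c) ≤ t * (D - 1) := Nat.mul_le_mul_left _ (by omega)
  rw [mul_add] at this
  omega

/-- If the linear conditions `∑ l (a,b,c) v^(b+c) Q_m = 0` hold, the auxiliary polynomial has a zero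
of order `≥ M` at each point of the fibre over `v`. -/
theorem le_rootMultiplicity_stepanovPoly {p : ℕ} [Fact p.Prime] {t : ℕ} (ht : 0 < t)
    {I : Finset (ℕ × ℕ × ℕ)} {l : ℕ × ℕ × ℕ → ZMod p} (h0 : stepanovPoly t I l ≠ 0)
    {v : ZMod p} (hv : v ≠ 0) {M : ℕ} (hM : M ≤ p)
    (hl : ∀ m < M, ∑ q ∈ I, C (l q * v ^ (q.2.1 + q.2.2)) *
      derivFactor (t * q.2.1) (t * q.2.2) (X ^ q.1) m = 0)
    {x : ZMod p} (hx : x ∈ fibre p t v) :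
    M ≤ (stepanovPoly t I l).rootMultiplicity x := by
  rcases Nat.eq_zero_or_pos M with rfl | hMpos
  · exact Nat.zero_le _
  have hx' : x ^ t = v ∧ (x - 1) ^ t = v := by simpa [fibre] using hx
  have hx0 : x ≠ 0 := by rintro rfl; exact hv (by rw [← hx'.1, zero_pow ht.ne'])
  have hx1 : x - 1 ≠ 0 := by intro h; exact hv (by rw [← hx'.2, h, zero_pow ht.ne'])
  have key : ∀ m < M, (derivative^[m] (stepanovPoly t I l)).IsRoot x := by
    intro m hm
    have h1 : (X * (X - 1)) ^ m * derivative^[m] (stepanovPoly t I l) =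
        ∑ q ∈ I, C (l q) * (derivFactor (t * q.2.1) (t * q.2.2) (X ^ q.1) m *
          X ^ (t * q.2.1) * (X - 1) ^ (t * q.2.2)) := by
      rw [stepanovPoly, iterate_derivative_finsetSum, Finset.mul_sum]
      refine Finset.sum_congr rfl fun q _ => ?_
      rw [iterate_derivative_C_mul, ← iterate_derivative_mul_pow]
      ring
    have h2 := congrArg (eval x) h1
    have h3 := congrArg (eval x) (hl m hm)
    simp only [eval_mul, eval_pow, eval_X, eval_sub, eval_one, eval_finsetSum, eval_C,
      eval_zero] at h2 h3
    -- On the fibre x^(tb) (x-1)^(tc) = v^(b+c) does not depend on x, so one polynomial identity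
    -- serves all its points.
    have h4 : ∑ q ∈ I, l q * (eval x (derivFactor (t * q.2.1) (t * q.2.2) (X ^ q.1) m) *
        x ^ (t * q.2.1) * (x - 1) ^ (t * q.2.2)) = 0 := by
      rw [← h3]
      refine Finset.sum_congr rfl fun q _ => ?_
      rw [pow_mul, pow_mul, hx'.1, hx'.2, pow_add]
      ring
    rw [h4] at h2
    exact (mul_eq_zero.1 h2).resolve_left (pow_ne_zero _ (mul_ne_zero hx0 hx1))
  have := lt_rootMultiplicity_of_isRoot_iterate_derivative_of_mem_nonZeroDivisors
    (n := M - 1) h0 (fun m hm => key m (by omega)) ?_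
  · omega
  -- Vanishing derivatives detect multiplicity M only if (M-1)! is invertible mod p, which holds
  -- since M ≤ p.
  · rw [mem_nonZeroDivisors_iff_ne_zero]
    intro h
    have := (ZMod.natCast_eq_zero_iff _ _).1 h
    have := ((Fact.out : p.Prime).dvd_factorial).1 this
    omega

theorem sum_rootMultiplicity_le {K : Type*} [Field K] [DecidableEq K] (P : K[X]) (s : Finset K) :
    ∑ x ∈ s, P.rootMultiplicity x ≤ P.natDegree := by
  calc ∑ x ∈ s, P.rootMultiplicity x = ∑ x ∈ s, P.roots.count x := by simp
    _ ≤ P.roots.card := by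
      rw [← Multiset.toFinset_sum_count_eq P.roots]
      calc _ = ∑ x ∈ s.filter (· ∈ P.roots.toFinset), P.roots.count x := by
            refine (Finset.sum_subset (Finset.filter_subset _ _) ?_).symm
            intro x hx hx'
            rw [Multiset.count_eq_zero]
            intro h
            exact hx' (Finset.mem_filter.2 ⟨hx, Multiset.mem_toFinset.2 h⟩)
        _ ≤ _ := Finset.sum_le_sum_of_subset (fun x hx => (Finset.mem_filter.1 hx).2)
    _ ≤ _ := card_roots' P

theorem fibre_card_le (p t : ℕ) [Fact p.Prime] (ht : 0 < t) (v : ZMod p) :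
    (fibre p t v).card ≤ t := by
  have h0 : (X ^ t - C v : (ZMod p)[X]) ≠ 0 := X_pow_sub_C_ne_zero ht v
  calc (fibre p t v).card ≤ (X ^ t - C v : (ZMod p)[X]).roots.toFinset.card := by
        refine Finset.card_le_card fun x hx => ?_
        have hx' : x ^ t = v ∧ (x - 1) ^ t = v := by simpa [fibre] using hx
        rw [Multiset.mem_toFinset, mem_roots h0]
        simp [hx'.1]
    _ ≤ _ := Multiset.toFinset_card_le _
    _ ≤ _ := card_roots' _
    _ = t := natDegree_X_pow_sub_C

theorem sum_range_add_id_mul_two (A N : ℕ) :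
    2 * ∑ m ∈ Finset.range N, (A + m) + N = 2 * A * N + N ^ 2 := by
  induction N with
  | zero => simp
  | succ N ih => rw [Finset.sum_range_succ]; nlinarith

/-- Stepanov's method for the fibres, with multiplicities equal to the sizes of the fibres. -/
theorem sum_sq_card_fibre_le {p : ℕ} [Fact p.Prime] {t A B D : ℕ} (ht : t < p) (hA : 0 < A)
    (hB : 0 < B) (hAB : A * B ≤ t) (hp : A - 1 + t * (B - 1) < p)
    (hD : 2 * A * ∑ v ∈ Finset.univ.erase (0 : ZMod p), (fibre p t v).card +
        ∑ v ∈ Finset.univ.erase (0 : ZMod p), (fibre p t v).card ^ 2 <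
      2 * A * ∑ b ∈ Finset.range B, (D - b) +
        ∑ v ∈ Finset.univ.erase (0 : ZMod p), (fibre p t v).card) :
    ∑ v ∈ Finset.univ.erase (0 : ZMod p), (fibre p t v).card ^ 2 ≤ A - 1 + t * (D - 1) := by
  classical
  have htpos : 0 < t := lt_of_lt_of_le (Nat.mul_pos hA hB) hAB
  set V := Finset.univ.erase (0 : ZMod p) with hV
  set N : ZMod p → ℕ := fun v => (fibre p t v).card with hN
  set I := Finset.range A ×ˢ trapezoid B D with hI
  -- One index (v, m, i) per linear equation: the i-th coefficient of the m-th condition over v.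
  -- Twice the number of equations over v is 2AN + N² - N with N = `N v`, which explains the form of
  -- `hD`.
  let J : Finset (Σ _ : ZMod p, Σ _ : ℕ, ℕ) :=
    V.sigma fun v => (Finset.range (N v)).sigma fun m => Finset.range (A + m)
  have hJ : J.card = ∑ v ∈ V, ∑ m ∈ Finset.range (N v), (A + m) := by
    simp [J, Finset.card_sigma]
  have hcount : J.card < I.card := by
    have h1 : 2 * J.card + ∑ v ∈ V, N v = 2 * A * ∑ v ∈ V, N v + ∑ v ∈ V, N v ^ 2 := by
      rw [hJ, Finset.mul_sum, Finset.mul_sum, ← Finset.sum_add_distrib, ← Finset.sum_add_distrib]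
      exact Finset.sum_congr rfl fun v _ => sum_range_add_id_mul_two A (N v)
    have h2 : 2 * I.card = 2 * A * ∑ b ∈ Finset.range B, (D - b) := by
      rw [hI, Finset.card_product, card_trapezoid, Finset.card_range]; ring
    have h3 : 2 * A * ∑ v ∈ V, N v + ∑ v ∈ V, N v ^ 2 <
      2 * A * ∑ b ∈ Finset.range B, (D - b) + ∑ v ∈ V, N v := hD
    omega
  let E : (I → ZMod p) → ℕ × ℕ × ℕ → ZMod p := fun l q => if h : q ∈ I then l ⟨q, h⟩ else 0
  let φ : (I → ZMod p) →ₗ[ZMod p] (J → ZMod p) :=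
    { toFun := fun l j => (∑ q : I, C (l q * j.1.1 ^ (q.1.2.1 + q.1.2.2)) *
        derivFactor (t * q.1.2.1) (t * q.1.2.2) (X ^ q.1.1) j.1.2.1).coeff j.1.2.2
      map_add' := by
        intro l l'
        ext j
        simp only [Pi.add_apply, finsetSum_coeff, coeff_C_mul, ← Finset.sum_add_distrib]
        exact Finset.sum_congr rfl fun q _ => by ring
      map_smul' := by
        intro c l
        ext j
        simp only [Pi.smul_apply, smul_eq_mul, finsetSum_coeff, coeff_C_mul, RingHom.id_apply,
          Finset.mul_sum]
        exact Finset.sum_congr rfl fun q _ => by ring }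
  have hker : LinearMap.ker φ ≠ ⊥ := by
    refine LinearMap.ker_ne_bot_of_finrank_lt ?_
    simpa using hcount
  obtain ⟨l, hl, hl0⟩ := (Submodule.ne_bot_iff _).1 hker
  rw [LinearMap.mem_ker] at hl
  have hF0 : stepanovPoly t I (E l) ≠ 0 := by
    refine stepanovPoly_ne_zero hAB hB hp _ ?_
    obtain ⟨q, hq⟩ := Function.ne_iff.1 hl0
    exact ⟨q.1, q.2, by simpa [E] using hq⟩
  have hvan : ∀ v ∈ V, ∀ m < N v, ∑ q ∈ I, C (E l q * v ^ (q.2.1 + q.2.2)) *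
      derivFactor (t * q.2.1) (t * q.2.2) (X ^ q.1) m = 0 := by
    intro v hv m hm
    ext i
    rw [coeff_zero]
    by_cases hi : i < A + m
    · have h1 := congrFun hl ⟨⟨v, m, i⟩, by simp [J, hv, hm, hi]⟩
      simp only [φ, LinearMap.coe_mk, AddHom.coe_mk, Pi.zero_apply] at h1
      rw [← Finset.sum_coe_sort]
      simpa [E] using h1
    · rw [finsetSum_coeff]
      refine Finset.sum_eq_zero fun q hq => ?_
      have hqA : q.1 < A := by
        simpa using (Finset.mem_product.1 hq).1
      have h2 := natDegree_derivFactor_le (K := ZMod p) (t * q.2.1) (t * q.2.2) (X ^ q.1) m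
      rw [natDegree_X_pow] at h2
      rw [coeff_C_mul, coeff_eq_zero_of_natDegree_lt (by omega), mul_zero]
  have hmult : ∀ v ∈ V, ∀ x ∈ fibre p t v, N v ≤ (stepanovPoly t I (E l)).rootMultiplicity x :=
    fun v hv x hx => le_rootMultiplicity_stepanovPoly htpos hF0 (by simpa [V] using hv)
      ((fibre_card_le p t htpos v).trans ht.le) (hvan v hv) hx
  calc ∑ v ∈ V, N v ^ 2 = ∑ v ∈ V, ∑ x ∈ fibre p t v, N v := by
        refine Finset.sum_congr rfl fun v _ => ?_
        rw [Finset.sum_const, smul_eq_mul, sq]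
    _ ≤ ∑ v ∈ V, ∑ x ∈ fibre p t v, (stepanovPoly t I (E l)).rootMultiplicity x :=
        Finset.sum_le_sum fun v hv => Finset.sum_le_sum fun x hx => hmult v hv x hx
    _ = ∑ x ∈ V.biUnion (fibre p t), (stepanovPoly t I (E l)).rootMultiplicity x := by
        refine (Finset.sum_biUnion ?_).symm
        intro v _ v' _ hvv'
        refine Finset.disjoint_left.2 fun x hx hx' => hvv' ?_
        simp only [fibre, Finset.mem_filter] at hx hx'
        exact hx.2.1.symm.trans hx'.2.1
    _ ≤ (stepanovPoly t I (E l)).natDegree := sum_rootMultiplicity_le _ _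
    _ ≤ _ := natDegree_stepanovPoly_le hA _

/-- All these points are roots of X^t - (X-1)^t, whose leading terms cancel and whose value at 0 is
nonzero. -/
theorem sum_card_fibre_lt {p : ℕ} [Fact p.Prime] {t : ℕ} (ht : 0 < t) :
    ∑ v ∈ Finset.univ.erase (0 : ZMod p), (fibre p t v).card < t := by
  classical
  set P : (ZMod p)[X] := X ^ t - (X - 1) ^ t with hP
  have hP0 : P ≠ 0 := by
    intro h
    have := congrArg (eval 0) h
    simp [hP, ht.ne'] at this
  have hm : (X - 1 : (ZMod p)[X]).Monic := by simpa using monic_X_sub_C (1 : ZMod p)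
  have hdeg : P.natDegree < t := by
    have h1 : P.degree < ((X : (ZMod p)[X]) ^ t).degree := by
      refine degree_sub_lt_left ?_ (pow_ne_zero _ X_ne_zero) ?_
      · rw [degree_X_pow, degree_pow, show (X - 1 : (ZMod p)[X]) = X - C 1 by simp, degree_X_sub_C]
        simp
      · rw [(monic_X_pow t).leadingCoeff, (hm.pow t).leadingCoeff]
    rw [degree_X_pow] at h1
    exact (natDegree_lt_iff_degree_lt hP0).2 h1
  refine lt_of_le_of_lt ?_ hdeg
  rw [← Finset.card_biUnion]
  · refine le_trans (Finset.card_le_card (t := P.roots.toFinset) ?_)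
      ((Multiset.toFinset_card_le _).trans (card_roots' P))
    intro x hx
    simp only [Finset.mem_biUnion, fibre, Finset.mem_filter] at hx
    obtain ⟨v, _, _, h1, h2⟩ := hx
    rw [Multiset.mem_toFinset, mem_roots hP0]
    simp [hP, h1, h2]
  · intro v _ v' _ hvv'
    refine Finset.disjoint_left.2 fun x hx hx' => hvv' ?_
    simp only [fibre, Finset.mem_filter] at hx hx'
    exact hx.2.1.symm.trans hx'.2.1

theorem two_mul_sum_range_sub {B D : ℕ} (h : B ≤ D) :
    2 * ∑ b ∈ Finset.range B, (D - b) + B * B = 2 * B * D + B := by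
  induction B with
  | zero => simp
  | succ B ih =>
    have := ih (by omega)
    rw [Finset.sum_range_succ]
    obtain ⟨e, rfl⟩ := Nat.exists_eq_add_of_le h
    rw [show B + 1 + e - B = e + 1 by omega]
    nlinarith

/-- The conclusion of Stepanov's method for given `A`, `B`, after optimizing `D`. -/
theorem stepanov_optimized {t W T A B : ℕ} (hT : T < t) (hA : 0 < A) (hB : 0 < B)
    (hS : ∀ D, 2 * A * T + W < 2 * A * ∑ b ∈ Finset.range B, (D - b) + T →
      W ≤ A - 1 + t * (D - 1)) :
    W ≤ A - 1 + t * (B - 1) ∨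
      2 * A * B * W ≤ 2 * A * B * (A - 1) +
        t * ((2 * A - 1) * (t - 1) + W + A * B * (B - 1)) := by
  -- With T ≤ t - 1 and D ≥ B the counting condition follows from q < 2ABD. The least such D is q /
  -- (2AB) + 1; when it does not exceed B, the choice D = B is used, because the closed form of the
  -- sum needs B ≤ D.
  set q := (2 * A - 1) * (t - 1) + W + A * B * (B - 1) with hq
  have hP : 0 < 2 * A * B := by positivity
  have hcond : ∀ D, B ≤ D → q < 2 * A * B * D →
      2 * A * T + W < 2 * A * ∑ b ∈ Finset.range B, (D - b) + T := by
    intro D hD hqD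
    have h1 := two_mul_sum_range_sub hD
    obtain ⟨A', rfl⟩ := Nat.exists_eq_add_of_lt hA
    obtain ⟨B', rfl⟩ := Nat.exists_eq_add_of_lt hB
    obtain ⟨e, rfl⟩ := Nat.exists_eq_add_of_lt hT
    simp only [zero_add] at *
    have e1 : 2 * (A' + 1) - 1 = 2 * A' + 1 := by omega
    have e2 : T + e + 1 - 1 = T + e := by omega
    have e3 : B' + 1 - 1 = B' := by omega
    rw [e1, e2, e3] at hq
    have h2 : (A' + 1) * (2 * ∑ b ∈ Finset.range (B' + 1), (D - b) + (B' + 1) * (B' + 1)) =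
      (A' + 1) * (2 * (B' + 1) * D + (B' + 1)) := by rw [h1]
    nlinarith [Nat.zero_le (A' * e)]
  by_cases hDB : q / (2 * A * B) + 1 ≤ B
  · left
    refine hS B (hcond B le_rfl ?_)
    exact (Nat.lt_mul_div_succ q hP).trans_le (Nat.mul_le_mul_left _ hDB)
  · right
    have h1 := hS _ (hcond (q / (2 * A * B) + 1) (by omega) (Nat.lt_mul_div_succ q hP))
    rw [Nat.add_sub_cancel] at h1
    calc 2 * A * B * W ≤ 2 * A * B * (A - 1 + t * (q / (2 * A * B))) := Nat.mul_le_mul_left _ h1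
      _ = 2 * A * B * (A - 1) + t * (2 * A * B * (q / (2 * A * B))) := by ring
      _ ≤ _ := by gcongr; exact Nat.mul_div_le _ _

/-! ### Choice of the parameters A and B. -/

/-- Numerical test that `A`, `B` are suitable exponents for Stepanov's method. -/
def suitable (t A B : ℕ) : Prop :=
  0 < A ∧ 0 < B ∧ A * B ≤ t ∧ (A - 1 + t * (B - 1)) ^ 3 ≤ 10 * t ^ 5 ∧
    ∀ W, 10 * t ^ 3 < (t + W) ^ 2 → A - 1 + t * (B - 1) < W ∧
      2 * A * B * (A - 1) + t * ((2 * A - 1) * (t - 1) + W + A * B * (B - 1)) < 2 * A * B * W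

/-- The failing range of W starts at R + 1 - t or later, and t ≤ 2AB makes the final inequality
monotone in W, so testing W = R + 1 - t suffices. -/
theorem suitable_of_check {t A B R : ℕ} (hA : 0 < A) (hB : 0 < B) (hAB : A * B ≤ t)
    (h1 : (A - 1 + t * (B - 1)) ^ 3 ≤ 10 * t ^ 5) (h2 : t ≤ 2 * A * B)
    (hR : R ^ 2 ≤ 10 * t ^ 3) (h3 : A - 1 + t * (B - 1) + t < R + 1)
    (h4 : 2 * A * B * (A - 1) + t * ((2 * A - 1) * (t - 1) + (R + 1 - t)
      + A * B * (B - 1)) < 2 * A * B * (R + 1 - t)) :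
    suitable t A B := by
  refine ⟨hA, hB, hAB, h1, fun W hW => ?_⟩
  have h5 : R < t + W := lt_of_pow_lt_pow_left₀ 2 (Nat.zero_le _) (hR.trans_lt hW)
  obtain ⟨e, he⟩ := Nat.exists_eq_add_of_le (show R + 1 - t ≤ W by omega)
  refine ⟨by omega, ?_⟩
  generalize R + 1 - t = W₀ at *
  subst he
  nlinarith [Nat.mul_le_mul_right e h2]

theorem suitable_small {t : ℕ} (ht : t ∈ Finset.Ico 12 121) : ∃ A B, suitable t A B := by
  -- Singleton lists act as `let` inside a decidable statement. A is of the size of √(t/3), and R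
  -- comes from six Newton steps for √(10t³) started at 35t, which lies above the root in this
  -- range; the listed inequalities recheck R.
  have : ∀ t ∈ Finset.Ico 12 121,
      ∀ A ∈ [if t < 27 then 2 else if t < 53 then 3 else if t < 91 then 4 else 5],
      ∀ B ∈ [t / A],
      ∀ R ∈ [(List.range 6).foldl (fun r _ => (r + 10 * t ^ 3 / r) / 2) (35 * t)],
      0 < A ∧ 0 < B ∧
      A * B ≤ t ∧ (A - 1 + t * (B - 1)) ^ 3 ≤ 10 * t ^ 5 ∧ t ≤ 2 * A * B ∧
      R ^ 2 ≤ 10 * t ^ 3 ∧ A - 1 + t * (B - 1) + t < R + 1 ∧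
      2 * A * B * (A - 1) + t * ((2 * A - 1) * (t - 1) + (R + 1 - t)
      + A * B * (B - 1)) < 2 * A * B * (R + 1 - t) := by
    decide +kernel
  obtain ⟨h1, h2, h3, h4, h5, h6, h7, h8⟩ := this t ht _ (List.mem_singleton.2 rfl) _
    (List.mem_singleton.2 rfl) _ (List.mem_singleton.2 rfl)
  exact ⟨_, _, suitable_of_check h1 h2 h3 h4 h5 h6 h7 h8⟩

/-- Right side minus left side is a concave quadratic in A, so positivity at A = 0.577s and A = 0.7s
(`e1`, `e2`) suffices; `hk` is the concavity surplus and 0.123 the length of the interval divided by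
s. -/
theorem suitable_large_aux {s A : ℝ} (hs : 11 ≤ s) (h1 : 0.577 * s ≤ A) (h2 : A ≤ 0.7 * s) :
    2 * A ^ 2 * s ^ 2 - 2 * A * s ^ 2 - A + s ^ 4 <
      (3.162 * s - 1) * A * (s ^ 2 - 2 * A + 2) := by
  have hs3 : 0 < s ^ 3 := by positivity
  have hs2 : 0 < s ^ 2 := by positivity
  have e1 : 0 < (3.162 * s - 1) * (0.577 * s) * (s ^ 2 - 2 * (0.577 * s) + 2)
      - (2 * (0.577 * s) ^ 2 * s ^ 2 - 2 * (0.577 * s) * s ^ 2 - (0.577 * s) + s ^ 4) := by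
    nlinarith [mul_nonneg hs3.le (sub_nonneg.2 hs), mul_nonneg hs2.le (sub_nonneg.2 hs),
      mul_nonneg (by linarith : (0:ℝ) ≤ s) (sub_nonneg.2 hs)]
  have e2 : 0 < (3.162 * s - 1) * (0.7 * s) * (s ^ 2 - 2 * (0.7 * s) + 2)
      - (2 * (0.7 * s) ^ 2 * s ^ 2 - 2 * (0.7 * s) * s ^ 2 - (0.7 * s) + s ^ 4) := by
    nlinarith [mul_nonneg hs3.le (sub_nonneg.2 hs), mul_nonneg hs2.le (sub_nonneg.2 hs),
      mul_nonneg (by linarith : (0:ℝ) ≤ s) (sub_nonneg.2 hs)]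
  have hk : 0 ≤ (2 * (3.162 * s - 1) + 2 * s ^ 2) * ((A - 0.577 * s) * (0.7 * s - A)) := by
    refine mul_nonneg (by nlinarith) (mul_nonneg (by linarith) (by linarith))
  have h3 := mul_nonneg (sub_nonneg.2 h2) e1.le
  have h4 := mul_nonneg (sub_nonneg.2 h1) e2.le
  have h5 : 0 < (0.7 * s - A) * ((3.162 * s - 1) * (0.577 * s) * (s ^ 2 - 2 * (0.577 * s) + 2)
      - (2 * (0.577 * s) ^ 2 * s ^ 2 - 2 * (0.577 * s) * s ^ 2 - (0.577 * s) + s ^ 4)) +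
      (A - 0.577 * s) * ((3.162 * s - 1) * (0.7 * s) * (s ^ 2 - 2 * (0.7 * s) + 2)
      - (2 * (0.7 * s) ^ 2 * s ^ 2 - 2 * (0.7 * s) * s ^ 2 - (0.7 * s) + s ^ 4)) := by
    rcases eq_or_lt_of_le h2 with h | h
    · have : 0 < A - 0.577 * s := by linarith
      have := mul_pos this e2
      linarith
    · have := mul_pos (sub_pos.2 h) e1
      linarith
  have h6 : 0 < (0.123 * s) * ((3.162 * s - 1) * A * (s ^ 2 - 2 * A + 2)
      - (2 * A ^ 2 * s ^ 2 - 2 * A * s ^ 2 - A + s ^ 4)) := by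
    have h7 := mul_nonneg (by linarith : (0:ℝ) ≤ 0.123 * s) hk
    linear_combination h5 + h7
  have := pos_of_mul_pos_right (b := (3.162 * s - 1) * A * (s ^ 2 - 2 * A + 2)
      - (2 * A ^ 2 * s ^ 2 - 2 * A * s ^ 2 - A + s ^ 4)) h6 (by linarith)
  linarith

/-- Multiplied by x, every occurrence of y enters through xy, which lies between s² + 1 - x and s²;
this eliminates y and the rounding in B. -/
theorem suitable_large_real {s x y W : ℝ} (hx : 0 < x) (hy : 1 ≤ y) (hW : 0 ≤ W) (hs : 0 < s)
    (h1 : x * y ≤ s ^ 2) (h2 : s ^ 2 + 1 ≤ x * y + x) (hW1 : 3.162 * s ^ 3 < s ^ 2 + W)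
    (h3 : 0 ≤ s ^ 2 - 2 * x + 2)
    (h : 2 * x ^ 2 * s ^ 2 - 2 * x * s ^ 2 - x + s ^ 4 <
      (3.162 * s - 1) * x * (s ^ 2 - 2 * x + 2)) :
    2 * x * y * (x - 1) + s ^ 2 * ((2 * x - 1) * (s ^ 2 - 1) + W + x * y * (y - 1)) <
      2 * x * y * W := by
  have g1 : x * y * (2 * (x - 1)) ≤ s ^ 2 * (2 * (x - 1)) :=
    mul_le_mul_of_nonneg_right h1 (by linarith)
  have g2 : s ^ 2 * (x * (x * y * (y - 1))) ≤ s ^ 2 * (s ^ 2 * (s ^ 2 - x)) := by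
    refine mul_le_mul_of_nonneg_left ?_ (by positivity)
    calc x * (x * y * (y - 1)) = x * y * (x * y - x) := by ring
      _ ≤ s ^ 2 * (s ^ 2 - x) :=
        mul_le_mul h1 (by linarith) (by nlinarith) (by positivity)
  have g3 : (3.162 * s ^ 3 - s ^ 2) * (x * (s ^ 2 - 2 * x + 2)) ≤
      W * (x * (2 * (x * y) - s ^ 2)) := by
    refine mul_le_mul (by linarith) ?_ (mul_nonneg hx.le h3) hW
    exact mul_le_mul_of_nonneg_left (by linarith) hx.le
  have g4 := mul_lt_mul_of_pos_left h (pow_pos hs 2)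
  have g5 := mul_le_mul_of_nonneg_left g1 hx.le
  refine lt_of_mul_lt_mul_left ?_ hx.le
  linear_combination g2 + g3 + g4 + g5

/-- To leading order the requirement is W > t(2A + t/A). For A near √(t/3) the right side is about
2.887 t^(3/2), while W exceeds about √10 t^(3/2); from t = 121 on, the gap absorbs the lower-order
terms. The constants 0.577, 1.7332 and 3.162 approximate 1/√3, √3 and √10. -/
theorem suitable_large {t : ℕ} (ht : 121 ≤ t) :
    suitable t (Nat.sqrt (t / 3) + 1) (t / (Nat.sqrt (t / 3) + 1)) := by
  set A := Nat.sqrt (t / 3) + 1 with hA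
  set B := t / A with hB
  have hA1 : t < 3 * A ^ 2 := by
    have := Nat.lt_succ_sqrt' (t / 3)
    rw [Nat.succ_eq_add_one, ← hA] at this
    omega
  have hA2 : 3 * (A - 1) ^ 2 ≤ t := by
    have := Nat.sqrt_le' (t / 3)
    rw [hA, Nat.add_sub_cancel]
    omega
  have hA0 : 0 < A := by omega
  have hAB : A * B ≤ t := Nat.mul_div_le _ _
  have hAB' : t < A * B + A := Nat.lt_mul_div_succ t hA0
  obtain ⟨a, ha⟩ : ∃ a, A = a + 1 := ⟨_, hA⟩
  have hApos : (0 : ℝ) < A := by exact_mod_cast hA0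
  set s : ℝ := √(t : ℝ) with hs
  have hss : s ^ 2 = t := Real.sq_sqrt (Nat.cast_nonneg t)
  have hs11 : 11 ≤ s := Real.le_sqrt_of_sq_le (by norm_num; exact_mod_cast ht)
  have hl : 0.577 * s ≤ A := by
    have h : (t : ℝ) ≤ 3 * (A : ℝ) ^ 2 := by exact_mod_cast hA1.le
    refine le_of_pow_le_pow_left₀ two_ne_zero hApos.le ?_
    rw [mul_pow, hss]; norm_num at *; linarith
  have hu : (A : ℝ) ≤ 0.7 * s := by
    have h : 3 * ((A : ℝ) - 1) ^ 2 ≤ t := by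
      rw [ha] at hA2 ⊢; push_cast
      have : 3 * a ^ 2 ≤ t := by simpa using hA2
      simpa using (by exact_mod_cast this : 3 * (a : ℝ) ^ 2 ≤ t)
    have h1 : (A : ℝ) - 1 ≤ 0.5774 * s := by
      refine le_of_pow_le_pow_left₀ two_ne_zero (by linarith) ?_
      rw [mul_pow, hss]; norm_num
      have : (0 : ℝ) ≤ t := Nat.cast_nonneg t
      linarith
    linarith
  have hmain := suitable_large_aux hs11 hl hu
  have hB0 : 0 < B := by
    rcases Nat.eq_zero_or_pos B with h | h
    · rw [h] at hAB'
      exfalso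
      have : (t : ℝ) < A := by exact_mod_cast (by simpa using hAB' : t < A)
      nlinarith
    · exact h
  obtain ⟨b, hb⟩ : ∃ b, B = b + 1 := ⟨B - 1, by omega⟩
  have hABr : (A : ℝ) * B ≤ s ^ 2 := by rw [hss]; exact_mod_cast hAB
  have hABr' : s ^ 2 + 1 ≤ (A : ℝ) * B + A := by
    rw [hss]; exact_mod_cast (by omega : t + 1 ≤ A * B + A)
  have hBpos : (0 : ℝ) < B := by exact_mod_cast hB0
  have hBs : (B : ℝ) ≤ 1.7332 * s := by
    by_contra h
    push Not at h
    nlinarith [mul_le_mul hl h.le (by linarith) hApos.le]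
  have hcA : ((A - 1 : ℕ) : ℝ) = A - 1 := by rw [Nat.cast_sub hA0]; simp
  have hcB : ((B - 1 : ℕ) : ℝ) = B - 1 := by rw [Nat.cast_sub hB0]; simp
  have hct : ((t - 1 : ℕ) : ℝ) = s ^ 2 - 1 := by rw [Nat.cast_sub (by omega), hss]; simp
  have hc2A : ((2 * A - 1 : ℕ) : ℝ) = 2 * A - 1 := by rw [Nat.cast_sub (by omega)]; push_cast; ring
  have hdeg : ((A - 1 + t * (B - 1) : ℕ) : ℝ) ≤ 1.7332 * s ^ 3 := by
    push_cast [hcA, hcB]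
    rw [← hss]
    have : s ^ 2 * B ≤ s ^ 2 * (1.7332 * s) := by gcongr
    nlinarith
  refine ⟨hA0, hB0, hAB, ?_, fun W hW => ?_⟩
  · have h1 : ((A - 1 + t * (B - 1) : ℕ) : ℝ) ^ 3 ≤ 10 * (t : ℝ) ^ 5 := by
      calc ((A - 1 + t * (B - 1) : ℕ) : ℝ) ^ 3 ≤ (1.7332 * s ^ 3) ^ 3 := by gcongr
        _ = 1.7332 ^ 3 * s ^ 9 := by ring
        _ ≤ 10 * s ^ 9 * s := by
          have : 0 < s ^ 9 := by positivity
          nlinarith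
        _ = _ := by rw [← hss]; ring
    exact_mod_cast h1
  · have hW1 : 3.162 * s ^ 3 < s ^ 2 + W := by
      have h1 : 10 * (t : ℝ) ^ 3 < ((t : ℝ) + W) ^ 2 := by exact_mod_cast hW
      rw [← hss] at h1
      refine lt_of_pow_lt_pow_left₀ 2 (by positivity) (lt_of_le_of_lt ?_ h1)
      have : 0 < s ^ 6 := by positivity
      nlinarith
    constructor
    · have : ((A - 1 + t * (B - 1) : ℕ) : ℝ) < W := by
        refine hdeg.trans_lt ?_
        nlinarith [pow_pos (by linarith : 0 < s) 2]
      exact_mod_cast this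
    · have : ((2 * A * B * (A - 1) + t * ((2 * A - 1) * (t - 1) + W + A * B * (B - 1)) : ℕ) : ℝ) <
          ((2 * A * B * W : ℕ) : ℝ) := by
        have h3 : 0 ≤ s ^ 2 - 2 * (A : ℝ) + 2 := by
          have := mul_le_mul_of_nonneg_right hs11 (by linarith : 0 ≤ s)
          rw [← sq] at this
          linarith
        push_cast [hcA, hcB, hct, hc2A]
        rw [← hss]
        exact suitable_large_real hApos (by exact_mod_cast hB0) (Nat.cast_nonneg W)
          (by linarith) hABr hABr' hW1 h3 hmain
      exact_mod_cast this

/-! ### Additive energy of the roots of unity. -/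

/-- The `t`-th roots of unity modulo `p`. -/
def rootsMod (p t : ℕ) [NeZero p] : Finset (ZMod p) :=
  Finset.univ.filter fun x => x ^ t = 1

/-- The number of representations `u = x - y` with `x`, `y` `t`-th roots of unity. -/
def diffCount (p t : ℕ) [NeZero p] (u : ZMod p) : ℕ :=
  (Finset.univ.filter fun y : ZMod p => y ^ t = 1 ∧ (y + u) ^ t = 1).card

theorem card_pow_eq_le {p t : ℕ} [Fact p.Prime] (ht : 0 < t) (w : ZMod p) :
    (Finset.univ.filter fun x : ZMod p => x ^ t = w).card ≤ t := by
  have h0 : (X ^ t - C w : (ZMod p)[X]) ≠ 0 := X_pow_sub_C_ne_zero ht w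
  calc _ ≤ (X ^ t - C w : (ZMod p)[X]).roots.toFinset.card := by
        refine Finset.card_le_card fun x hx => ?_
        rw [Multiset.mem_toFinset, mem_roots h0]
        simp [(Finset.mem_filter.1 hx).2]
    _ ≤ _ := Multiset.toFinset_card_le _
    _ ≤ _ := card_roots' _
    _ = t := natDegree_X_pow_sub_C

/-- Dividing a representation u = (y + u) - y by u gives x - (x - 1) = 1 with x = (y + u)/u. -/
theorem diffCount_eq_card_fibre {p t : ℕ} [Fact p.Prime] {u : ZMod p} (hu : u ≠ 0) :
    diffCount p t u = (fibre p t (u⁻¹ ^ t)).card := by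
  refine Finset.card_bij' (fun y _ => (y + u) * u⁻¹) (fun x _ => x * u - u) ?_ ?_ ?_ ?_
  · intro y hy
    simp only [Finset.mem_filter, Finset.mem_univ, true_and, fibre] at hy ⊢
    refine ⟨by rw [mul_pow, hy.2, one_mul], ?_⟩
    rw [add_mul, mul_inv_cancel₀ hu, add_sub_cancel_right, mul_pow, hy.1, one_mul]
  · intro x hx
    simp only [Finset.mem_filter, Finset.mem_univ, true_and, fibre] at hx ⊢
    have h1 : u⁻¹ ^ t * u ^ t = 1 := by rw [← mul_pow, inv_mul_cancel₀ hu, one_pow]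
    refine ⟨?_, ?_⟩
    · rw [show x * u - u = (x - 1) * u by ring, mul_pow, hx.2, h1]
    · rw [sub_add_cancel, mul_pow, hx.1, h1]
  · intro y _
    rw [mul_assoc, inv_mul_cancel₀ hu]; ring
  · intro x _
    rw [sub_add_cancel, mul_assoc, mul_inv_cancel₀ hu, mul_one]

theorem diffCount_zero_le {p t : ℕ} [Fact p.Prime] (ht : 0 < t) : diffCount p t 0 ≤ t := by
  simpa [diffCount] using card_pow_eq_le ht (1 : ZMod p)

/-- The term u = 0 gives at most t²; every other u belongs to v = u^(-t), and each v arises from at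
most t values of u. -/
theorem sum_sq_diffCount_le {p t : ℕ} [Fact p.Prime] (ht : 0 < t) :
    ∑ u : ZMod p, diffCount p t u ^ 2 ≤
      t ^ 2 + t * ∑ v ∈ Finset.univ.erase (0 : ZMod p), (fibre p t v).card ^ 2 := by
  classical
  rw [← Finset.add_sum_erase _ _ (Finset.mem_univ (0 : ZMod p))]
  refine add_le_add (Nat.pow_le_pow_left (diffCount_zero_le ht) 2) ?_
  have hmaps : ∀ u ∈ Finset.univ.erase (0 : ZMod p), u⁻¹ ^ t ∈ Finset.univ.erase (0 : ZMod p) := by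
    intro u hu
    simp only [Finset.mem_erase, Finset.mem_univ, and_true] at hu ⊢
    exact pow_ne_zero _ (inv_ne_zero hu)
  rw [← Finset.sum_fiberwise_of_maps_to hmaps, Finset.mul_sum]
  refine Finset.sum_le_sum fun v _ => ?_
  calc _ = ∑ u ∈ (Finset.univ.erase (0 : ZMod p)).filter (fun u => u⁻¹ ^ t = v),
        (fibre p t v).card ^ 2 := by
        refine Finset.sum_congr rfl fun u hu => ?_
        simp only [Finset.mem_filter, Finset.mem_erase, Finset.mem_univ, and_true] at hu
        rw [diffCount_eq_card_fibre hu.1, hu.2]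
    _ = _ * (fibre p t v).card ^ 2 := by rw [Finset.sum_const, smul_eq_mul]
    _ ≤ t * (fibre p t v).card ^ 2 := by
        refine Nat.mul_le_mul_right _ ((Finset.card_le_card ?_).trans
          (card_pow_eq_le ht (v⁻¹ : ZMod p)))
        intro u hu
        simp only [Finset.mem_filter, Finset.mem_univ, true_and] at hu ⊢
        rw [← hu.2, inv_pow, inv_inv]

/-- The additive energy of the group of `t`-th roots of unity is at most `√10 t ^ (5/2)`. -/
theorem energy_sq_le {p t : ℕ} [Fact p.Prime] (ht : 0 < t) (htp : t < p)
    (hp : 10 * t ^ 5 < p ^ 3) :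
    (∑ u : ZMod p, diffCount p t u ^ 2) ^ 2 ≤ 10 * t ^ 5 := by
  classical
  set W := ∑ v ∈ Finset.univ.erase (0 : ZMod p), (fibre p t v).card ^ 2 with hW
  set T := ∑ v ∈ Finset.univ.erase (0 : ZMod p), (fibre p t v).card with hT
  have hTt : T < t := sum_card_fibre_lt ht
  have hWT : W ≤ T ^ 2 := by
    rw [sq, hT, Finset.sum_mul, hW]
    refine Finset.sum_le_sum fun v hv => ?_
    rw [sq]
    exact Nat.mul_le_mul_left _
      (Finset.single_le_sum (f := fun v => (fibre p t v).card) (fun _ _ => Nat.zero_le _) hv)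
  have key : (t + W) ^ 2 ≤ 10 * t ^ 3 := by
    by_contra hcon
    push Not at hcon
    have hsuit : ∃ A B, suitable t A B := by
      -- For t ≤ 11 the trivial W ≤ (t-1)² already gives (t + W)² ≤ 10t³; this argument first fails
      -- at t = 12.
      rcases lt_or_ge t 12 with h | h
      · exfalso
        have h1 : t + W ≤ t + (t - 1) ^ 2 :=
          Nat.add_le_add_left (hWT.trans (Nat.pow_le_pow_left (by omega) 2)) _
        have h2 := hcon.trans_le (Nat.pow_le_pow_left h1 2)
        interval_cases t <;> omega
      · rcases lt_or_ge t 121 with h' | h'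
        · exact suitable_small (Finset.mem_Ico.2 ⟨h, h'⟩)
        · exact ⟨_, _, suitable_large h'⟩
    obtain ⟨A, B, hA, hB, hAB, h3, h4⟩ := hsuit
    have hdeg : A - 1 + t * (B - 1) < p :=
      lt_of_pow_lt_pow_left₀ 3 (Nat.zero_le _) (h3.trans_lt hp)
    obtain ⟨h5, h6⟩ := h4 W hcon
    rcases stepanov_optimized hTt hA hB
      (fun D hD => sum_sq_card_fibre_le htp hA hB hAB hdeg hD) with h | h
    · exact absurd h5 (not_lt.2 h)
    · exact absurd h6 (not_lt.2 h)
  calc _ ≤ (t ^ 2 + t * W) ^ 2 := Nat.pow_le_pow_left (sum_sq_diffCount_le ht) 2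
    _ = t ^ 2 * (t + W) ^ 2 := by ring
    _ ≤ t ^ 2 * (10 * t ^ 3) := Nat.mul_le_mul_left _ key
    _ = _ := by ring

/-! ### Moments of exponential sums over the roots of unity. -/

/-- The exponential sum over the `t`-th roots of unity modulo `p`. -/
noncomputable def expSum (p t : ℕ) [NeZero p] (a : ZMod p) : ℂ :=
  ∑ h ∈ rootsMod p t, ZMod.stdAddChar (a * h)

/-- Parseval's identity; it yields the second moment from the indicator of H and the fourth from
`diffCount`. -/
theorem sum_norm_sq_fourier {p : ℕ} [Fact p.Prime] (f : ZMod p → ℂ) :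
    ∑ b : ZMod p, ‖∑ u, f u * ZMod.stdAddChar (b * u)‖ ^ 2 = p * ∑ u, ‖f u‖ ^ 2 := by
  have h : ((∑ b : ZMod p, ‖∑ u, f u * ZMod.stdAddChar (b * u)‖ ^ 2 : ℝ) : ℂ) =
      ((p * ∑ u, ‖f u‖ ^ 2 : ℝ) : ℂ) := by
    push_cast
    simp only [← Complex.mul_conj', map_sum, map_mul, ← AddChar.map_neg_eq_conj,
      Finset.sum_mul_sum]
    rw [Finset.sum_comm, Finset.mul_sum]
    refine Finset.sum_congr rfl fun u _ => ?_
    rw [Finset.sum_comm]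
    have : ∀ w : ZMod p, ∑ b : ZMod p, f u * ZMod.stdAddChar (b * u) *
        ((starRingEnd ℂ) (f w) * ZMod.stdAddChar (-(b * w))) =
        if w = u then (p : ℂ) * (f u * (starRingEnd ℂ) (f u)) else 0 := by
      intro w
      have h1 : ∀ b : ZMod p, f u * ZMod.stdAddChar (b * u) *
        ((starRingEnd ℂ) (f w) * ZMod.stdAddChar (-(b * w))) =
        (f u * (starRingEnd ℂ) (f w)) * ZMod.stdAddChar (b * (u - w)) := by
        intro b
        rw [show b * (u - w) = b * u + -(b * w) by ring, AddChar.map_add_eq_mul]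
        ring
      simp only [h1]
      rw [← Finset.mul_sum, AddChar.sum_mulShift _ (ZMod.isPrimitive_stdAddChar p)]
      by_cases hw : w = u
      · subst hw; simp [mul_comm]
      · rw [if_neg hw, if_neg (sub_ne_zero.2 (Ne.symm hw))]; simp
    simp only [this, Finset.sum_ite_eq', Finset.mem_univ, if_true]
  exact_mod_cast h

theorem expSum_eq_sum_ite {p t : ℕ} [Fact p.Prime] (a : ZMod p) :
    expSum p t a = ∑ u : ZMod p, (if u ^ t = 1 then 1 else 0) * ZMod.stdAddChar (a * u) := by
  rw [expSum, rootsMod, Finset.sum_filter]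
  exact Finset.sum_congr rfl fun u _ => by split_ifs <;> simp

theorem sum_norm_sq_expSum {p t : ℕ} [Fact p.Prime] :
    ∑ b : ZMod p, ‖expSum p t b‖ ^ 2 = p * (rootsMod p t).card := by
  simp only [expSum_eq_sum_ite]
  rw [sum_norm_sq_fourier, rootsMod, Finset.card_filter]
  push_cast
  congr 1
  exact Finset.sum_congr rfl fun u _ => by split_ifs <;> simp

theorem norm_sq_expSum {p t : ℕ} [Fact p.Prime] (b : ZMod p) :
    ((‖expSum p t b‖ ^ 2 : ℝ) : ℂ) =
      ∑ u : ZMod p, (diffCount p t u : ℂ) * ZMod.stdAddChar (b * u) := by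
  push_cast
  rw [← Complex.mul_conj', expSum_eq_sum_ite, map_sum, Finset.sum_mul_sum, Finset.sum_comm]
  have h1 : ∀ y : ZMod p, ∑ x : ZMod p, (if x ^ t = 1 then (1 : ℂ) else 0) *
      ZMod.stdAddChar (b * x) * (starRingEnd ℂ) ((if y ^ t = 1 then (1 : ℂ) else 0) *
      ZMod.stdAddChar (b * y)) = ∑ u : ZMod p,
      (if y ^ t = 1 ∧ (y + u) ^ t = 1 then (1 : ℂ) else 0) * ZMod.stdAddChar (b * u) := by
    intro y
    rw [← Equiv.sum_comp (Equiv.addLeft y)]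
    refine Finset.sum_congr rfl fun u _ => ?_
    simp only [Equiv.coe_addLeft, map_mul, ← AddChar.map_neg_eq_conj]
    rw [show b * u = b * (y + u) + -(b * y) by ring, AddChar.map_add_eq_mul]
    by_cases h2 : y ^ t = 1 <;> by_cases h3 : (y + u) ^ t = 1 <;> simp [h2, h3]
  simp only [h1]
  rw [Finset.sum_comm]
  refine Finset.sum_congr rfl fun u _ => ?_
  rw [← Finset.sum_mul, diffCount, Finset.card_filter]
  push_cast
  rfl

theorem sum_norm_pow_four_expSum {p t : ℕ} [Fact p.Prime] :
    ∑ b : ZMod p, ‖expSum p t b‖ ^ 4 = p * ∑ u : ZMod p, (diffCount p t u : ℝ) ^ 2 := by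
  have h := sum_norm_sq_fourier (p := p) (fun u => (diffCount p t u : ℂ))
  simp only [← norm_sq_expSum, Complex.norm_natCast, Complex.norm_real, norm_pow, norm_norm] at h
  rw [← h]
  exact Finset.sum_congr rfl fun b _ => by ring

theorem sum_rootsMod_mul {p t : ℕ} [Fact p.Prime] (ht : 0 < t) {M : Type*} [AddCommMonoid M]
    (f : ZMod p → M) {k : ZMod p} (hk : k ∈ rootsMod p t) :
    ∑ h ∈ rootsMod p t, f (k * h) = ∑ h ∈ rootsMod p t, f h := by
  simp only [rootsMod, Finset.mem_filter, Finset.mem_univ, true_and] at hk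
  have hk0 : k ≠ 0 := by rintro rfl; simp [ht.ne'] at hk
  refine Finset.sum_bij' (fun h _ => k * h) (fun h _ => k⁻¹ * h) ?_ ?_ ?_ ?_ ?_
  · intro h hh
    simp only [rootsMod, Finset.mem_filter, Finset.mem_univ, true_and] at hh ⊢
    rw [mul_pow, hk, hh, one_mul]
  · intro h hh
    simp only [rootsMod, Finset.mem_filter, Finset.mem_univ, true_and] at hh ⊢
    rw [mul_pow, inv_pow, hk, hh, inv_one, one_mul]
  · intro h _; rw [inv_mul_cancel_left₀ hk0]
  · intro h _; rw [mul_inv_cancel_left₀ hk0]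
  · intro h _; rfl

theorem expSum_mul_root {p t : ℕ} [Fact p.Prime] (ht : 0 < t) (a : ZMod p) {k : ZMod p}
    (hk : k ∈ rootsMod p t) : expSum p t (a * k) = expSum p t a := by
  simp only [expSum, mul_assoc]
  exact sum_rootsMod_mul ht (fun h => ZMod.stdAddChar (a * h)) hk

/-- The sum takes the same value at the t points of aH, and the second moment over all frequencies
is pt. -/
theorem norm_expSum_sq_le {p t : ℕ} [Fact p.Prime] (ht : 0 < t)
    (hcard : (rootsMod p t).card = t) {a : ZMod p} (ha : a ≠ 0) :
    ‖expSum p t a‖ ^ 2 ≤ p := by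
  classical
  have h1 : t * ‖expSum p t a‖ ^ 2 ≤ p * (t : ℝ) := by
    calc t * ‖expSum p t a‖ ^ 2 = ∑ h ∈ rootsMod p t, ‖expSum p t (a * h)‖ ^ 2 := by
          rw [Finset.sum_congr rfl (fun h hh => by rw [expSum_mul_root ht a hh]),
            Finset.sum_const, hcard, nsmul_eq_mul]
      _ = ∑ b ∈ (rootsMod p t).image (a * ·), ‖expSum p t b‖ ^ 2 := by
          rw [Finset.sum_image fun x _ y _ h => mul_left_cancel₀ ha h]
      _ ≤ ∑ b : ZMod p, ‖expSum p t b‖ ^ 2 :=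
          Finset.sum_le_sum_of_subset_of_nonneg (Finset.subset_univ _) fun _ _ _ => by positivity
      _ = _ := by rw [sum_norm_sq_expSum, hcard]
  have : (0 : ℝ) < t := by exact_mod_cast ht
  nlinarith

theorem sum_diffCount {p t : ℕ} [Fact p.Prime] :
    ∑ u : ZMod p, diffCount p t u = (rootsMod p t).card ^ 2 := by
  simp only [diffCount, Finset.card_filter]
  rw [Finset.sum_comm, sq, rootsMod, Finset.card_filter, Finset.sum_mul_sum]
  refine Finset.sum_congr rfl fun y _ => ?_
  rw [← Equiv.sum_comp (Equiv.addLeft y) (fun j => (if y ^ t = 1 then 1 else 0) *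
    (if j ^ t = 1 then 1 else 0))]
  refine Finset.sum_congr rfl fun u _ => ?_
  by_cases h2 : y ^ t = 1 <;> by_cases h3 : (y + u) ^ t = 1 <;> simp [h2, h3]

/-- Averaging |s|² over aH gives t|s(a)|² = ∑ J(u) s(au). Cauchy–Schwarz is applied twice: first
with weight J, of total mass t², then to separate J from |s|², whose fourth moment is pE. -/
theorem norm_expSum_pow_eight_le {p t : ℕ} [Fact p.Prime] (ht : 0 < t)
    (hcard : (rootsMod p t).card = t) {a : ZMod p} (ha : a ≠ 0) :
    ‖expSum p t a‖ ^ 8 ≤ p * (∑ u : ZMod p, (diffCount p t u : ℝ) ^ 2) ^ 2 := by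
  set J : ZMod p → ℝ := fun u => diffCount p t u with hJ
  set s : ZMod p → ℝ := fun u => ‖expSum p t (a * u)‖ with hs
  have hJ0 : ∀ u, 0 ≤ J u := fun u => Nat.cast_nonneg _
  have hsum : ∑ u, J u = (t : ℝ) ^ 2 := by
    simp only [hJ]
    exact_mod_cast (sum_diffCount (p := p) (t := t)).trans (by rw [hcard])
  have h1 : t * ‖expSum p t a‖ ^ 2 ≤ ∑ u, J u * s u := by
    have h2 : ((t * ‖expSum p t a‖ ^ 2 : ℝ) : ℂ) = ∑ u : ZMod p, (J u : ℂ) * expSum p t (a * u) := by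
      have h3 : ((t * ‖expSum p t a‖ ^ 2 : ℝ) : ℂ) =
          ∑ h ∈ rootsMod p t, ((‖expSum p t (a * h)‖ ^ 2 : ℝ) : ℂ) := by
        rw [Finset.sum_congr rfl (fun h hh => by rw [expSum_mul_root ht a hh]),
            Finset.sum_const, hcard, nsmul_eq_mul]
        push_cast; rfl
      rw [h3]
      simp only [norm_sq_expSum]
      rw [Finset.sum_comm]
      refine Finset.sum_congr rfl fun u _ => ?_
      rw [← Finset.mul_sum, expSum]
      simp only [hJ, Complex.ofReal_natCast]
      congr 1
      exact Finset.sum_congr rfl fun h _ => by congr 1; ring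
    have h3 : ‖((t * ‖expSum p t a‖ ^ 2 : ℝ) : ℂ)‖ = t * ‖expSum p t a‖ ^ 2 := by
      rw [Complex.norm_real, Real.norm_of_nonneg (by positivity)]
    rw [← h3, h2]
    refine (norm_sum_le _ _).trans (le_of_eq (Finset.sum_congr rfl fun u _ => ?_))
    rw [norm_mul, Complex.norm_real, Real.norm_of_nonneg (hJ0 u)]
  have h2 : (∑ u, J u * s u) ^ 2 ≤ (∑ u, J u) * ∑ u, J u * s u ^ 2 :=
    Finset.sum_sq_le_sum_mul_sum_of_sq_le_mul _ (fun u _ => hJ0 u)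
      (fun u _ => mul_nonneg (hJ0 u) (sq_nonneg _)) (fun u _ => le_of_eq (by ring))
  have h3 : (∑ u, J u * s u ^ 2) ^ 2 ≤ (∑ u, J u ^ 2) * ∑ u, s u ^ 4 :=
    Finset.sum_sq_le_sum_mul_sum_of_sq_le_mul _ (fun u _ => by positivity)
      (fun u _ => by positivity) (fun u _ => le_of_eq (by ring))
  have h4 : ∑ u, s u ^ 4 = p * ∑ u, J u ^ 2 := by
    rw [← sum_norm_pow_four_expSum]
    exact Equiv.sum_comp (Equiv.mulLeft₀ a ha) (fun b => ‖expSum p t b‖ ^ 4)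
  set F := ∑ u, J u * s u ^ 2 with hF
  set E := ∑ u, J u ^ 2 with hE
  have ht' : (0 : ℝ) < t := by exact_mod_cast ht
  rw [h4] at h3
  rw [hsum] at h2
  have h5 : (t : ℝ) ^ 4 * ‖expSum p t a‖ ^ 8 ≤ (t : ℝ) ^ 4 * (p * E ^ 2) := by
    calc (t : ℝ) ^ 4 * ‖expSum p t a‖ ^ 8 = ((t * ‖expSum p t a‖ ^ 2) ^ 2) ^ 2 := by ring
      _ ≤ ((∑ u, J u * s u) ^ 2) ^ 2 := by gcongr
      _ ≤ ((t : ℝ) ^ 2 * F) ^ 2 := by gcongr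
      _ = (t : ℝ) ^ 4 * F ^ 2 := by ring
      _ ≤ (t : ℝ) ^ 4 * (E * (p * E)) := by gcongr
      _ = _ := by ring
  exact le_of_mul_le_mul_left h5 (by positivity)

/-! ### Gauss sums as sums over the roots of unity. -/

/-- The dt nonzero residues map into at most t roots with at most d preimages each, so equality
holds throughout. -/
theorem rootsMod_card_and_fibre {p d t : ℕ} [Fact p.Prime] (hd : 0 < d) (ht : 0 < t)
    (hdt : d * t = p - 1) :
    (rootsMod p t).card = t ∧ ∀ h ∈ rootsMod p t,
      ((Finset.univ.erase (0 : ZMod p)).filter fun x => x ^ d = h).card = d := by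
  classical
  have hle : ∀ h, ((Finset.univ.erase (0 : ZMod p)).filter fun x => x ^ d = h).card ≤ d := by
    intro h
    refine (Finset.card_le_card ?_).trans (card_pow_eq_le hd h)
    exact Finset.filter_subset_filter _ (Finset.subset_univ _)
  have hmaps : ∀ x ∈ Finset.univ.erase (0 : ZMod p), x ^ d ∈ rootsMod p t := by
    intro x hx
    simp only [Finset.mem_erase, Finset.mem_univ, and_true] at hx
    simp only [rootsMod, Finset.mem_filter, Finset.mem_univ, true_and]
    rw [← pow_mul, hdt, ZMod.pow_card_sub_one_eq_one hx]
  have hsum := Finset.card_eq_sum_card_fiberwise hmaps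
  have hp1 : (Finset.univ.erase (0 : ZMod p)).card = d * t := by
    rw [Finset.card_erase_of_mem (Finset.mem_univ _), Finset.card_univ, ZMod.card, hdt]
  have hHt : (rootsMod p t).card ≤ t := card_pow_eq_le ht 1
  rw [hp1] at hsum
  have h1 : d * t ≤ d * (rootsMod p t).card := by
    rw [hsum, mul_comm]
    exact Finset.sum_le_card_nsmul _ _ _ fun h _ => hle h
  have hH : (rootsMod p t).card = t := le_antisymm hHt (Nat.le_of_mul_le_mul_left h1 hd)
  refine ⟨hH, ?_⟩
  have h2 : ∑ h ∈ rootsMod p t,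
      ((Finset.univ.erase (0 : ZMod p)).filter fun x => x ^ d = h).card =
      ∑ h ∈ rootsMod p t, d := by
    rw [← hsum, Finset.sum_const, hH, smul_eq_mul, mul_comm]
  exact (Finset.sum_eq_sum_iff_of_le fun h _ => hle h).1 h2

theorem gaussS_eq {p d t : ℕ} [Fact p.Prime] (hd : 0 < d) (ht : 0 < t)
    (hdt : d * t = p - 1) (a : ℤ) :
    gaussS d a p = 1 + d * expSum p t a := by
  classical
  have h1 : gaussS d a p = ∑ x : ZMod p, ZMod.stdAddChar ((a : ZMod p) * x ^ d) := by
    refine Finset.sum_bij' (fun x _ => (x : ZMod p)) (fun x _ => x.val) ?_ ?_ ?_ ?_ ?_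
    · intro x _; exact Finset.mem_univ _
    · intro x _; exact Finset.mem_range.2 (ZMod.val_lt x)
    · intro x hx; exact ZMod.val_cast_of_lt (Finset.mem_range.1 hx)
    · intro x _; exact ZMod.natCast_zmod_val x
    · intro x _
      have : ((a : ZMod p) * (x : ZMod p) ^ d) = ((a * (x : ℤ) ^ d : ℤ) : ZMod p) := by
        push_cast; ring
      rw [this, ZMod.stdAddChar_coe]
      congr 1
      push_cast
      ring
  rw [h1, ← Finset.add_sum_erase _ _ (Finset.mem_univ (0 : ZMod p)), zero_pow hd.ne', mul_zero,
    AddChar.map_zero_eq_one]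
  congr 1
  have hmaps : ∀ x ∈ Finset.univ.erase (0 : ZMod p), x ^ d ∈ rootsMod p t := by
    intro x hx
    simp only [Finset.mem_erase, Finset.mem_univ, and_true] at hx
    simp only [rootsMod, Finset.mem_filter, Finset.mem_univ, true_and]
    rw [← pow_mul, hdt, ZMod.pow_card_sub_one_eq_one hx]
  rw [← Finset.sum_fiberwise_of_maps_to hmaps, expSum, Finset.mul_sum]
  refine Finset.sum_congr rfl fun h hh => ?_
  rw [Finset.sum_congr rfl (fun x hx => by rw [(Finset.mem_filter.1 hx).2]), Finset.sum_const,
    (rootsMod_card_and_fibre hd ht hdt).2 h hh, nsmul_eq_mul]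

/-! ### The deficiency of an exponential sum. -/

/-- The deficiency `∑_{h ∈ H} (1 - cos (2 π b h / p))`. -/
noncomputable def deficiency (p t : ℕ) [NeZero p] (b : ZMod p) : ℝ :=
  ∑ h ∈ rootsMod p t, (1 - Real.cos (2 * Real.pi * (((b * h).valMinAbs : ℝ) / p)))

theorem re_stdAddChar {p : ℕ} [NeZero p] (x : ZMod p) :
    (ZMod.stdAddChar x).re = Real.cos (2 * Real.pi * ((x.valMinAbs : ℝ) / p)) := by
  conv_lhs => rw [← ZMod.coe_valMinAbs x]
  rw [ZMod.stdAddChar_coe,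
    show (2 * Real.pi * Complex.I * (x.valMinAbs : ℂ) / p : ℂ) =
      ((2 * Real.pi * ((x.valMinAbs : ℝ) / p) : ℝ) : ℂ) * Complex.I by push_cast; ring,
    Complex.exp_ofReal_mul_I_re]

theorem re_expSum {p t : ℕ} [Fact p.Prime] (b : ZMod p) :
    (expSum p t b).re = (rootsMod p t).card - deficiency p t b := by
  rw [expSum, deficiency, Complex.re_sum, Finset.sum_sub_distrib]
  simp [re_stdAddChar]

/-- In the double sum for |s(a)|² the substitution h' = hk makes each difference a(h' - h) equal to
a(k-1)h, so |s(a)|² = ∑_k s(a(k-1)); real parts are then taken. -/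
theorem sq_sub_norm_sq_expSum {p t : ℕ} [Fact p.Prime] (ht : 0 < t)
    (hcard : (rootsMod p t).card = t) (a : ZMod p) :
    (t : ℝ) ^ 2 - ‖expSum p t a‖ ^ 2 = ∑ k ∈ rootsMod p t, deficiency p t (a * (k - 1)) := by
  have h1 : ((‖expSum p t a‖ ^ 2 : ℝ) : ℂ) = ∑ k ∈ rootsMod p t, expSum p t (a * (k - 1)) := by
    push_cast
    rw [← Complex.mul_conj', mul_comm]
    conv_lhs => rw [expSum]
    rw [map_sum, Finset.sum_mul]
    simp only [expSum]
    rw [Finset.sum_comm (s := rootsMod p t) (t := rootsMod p t)]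
    refine Finset.sum_congr rfl fun h hh => ?_
    rw [← sum_rootsMod_mul ht _ hh, Finset.mul_sum]
    refine Finset.sum_congr rfl fun k _ => ?_
    rw [← AddChar.map_neg_eq_conj, ← AddChar.map_add_eq_mul]
    congr 1; ring
  have h2 := congrArg Complex.re h1
  rw [Complex.ofReal_re, Complex.re_sum] at h2
  rw [h2]
  simp only [re_expSum, hcard]
  rw [Finset.sum_sub_distrib, Finset.sum_const, hcard, nsmul_eq_mul]
  ring

/-! ### Hermite's constant and lattices orthogonal to a vector. -/

theorem dotProduct_mulVec_conjTranspose_mul {k : ℕ} (B : Matrix (Fin k) (Fin k) ℝ)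
    (x : Fin k → ℝ) : x ⬝ᵥ ((B.conjTranspose * B).mulVec x) = ∑ i, (B.mulVec x i) ^ 2 := by
  rw [← Matrix.mulVec_mulVec, Matrix.dotProduct_mulVec, Matrix.conjTranspose_eq_transpose_of_trivial,
    Matrix.vecMul_transpose, dotProduct]
  exact Finset.sum_congr rfl fun i _ => (sq _).symm

theorem form_nonneg {k : ℕ} {A : Matrix (Fin k) (Fin k) ℝ} (hA : A.PosDef) (x : Fin k → ℝ) :
    0 ≤ x ⬝ᵥ (A.mulVec x) := by
  simpa using hA.posSemidef.dotProduct_mulVec_nonneg x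

/-- Minkowski's theorem on linear forms, with a wasteful constant. -/
theorem exists_int_small {k : ℕ} (hk : 0 < k) (B : Matrix (Fin k) (Fin k) ℝ) (hB : B.det ≠ 0) :
    ∃ z : Fin k → ℤ, z ≠ 0 ∧
      ∀ i, |B.mulVec (fun j => (z j : ℝ)) i| ≤ 2 * |B.det| ^ (1 / (k : ℝ)) := by
  classical
  open MeasureTheory in
  -- Radius twice the critical one: the preimage of the cube has volume 4^k, strictly above the 2^k
  -- in Minkowski's theorem.
  set ρ : ℝ := 2 * |B.det| ^ (1 / (k : ℝ)) with hρ
  have hdet : 0 < |B.det| := abs_pos.2 hB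
  have hρ0 : 0 < ρ := by positivity
  have hρk : ρ ^ k = 2 ^ k * |B.det| := by
    rw [hρ, mul_pow, ← Real.rpow_natCast (|B.det| ^ (1 / (k : ℝ))), ← Real.rpow_mul hdet.le,
      one_div_mul_cancel (by exact_mod_cast hk.ne'), Real.rpow_one]
  let b := Pi.basisFun ℝ (Fin k)
  have hdetL : LinearMap.det (Matrix.toLin' B) ≠ 0 := by rwa [LinearMap.det_toLin']
  have hfund := ZSpan.isAddFundamentalDomain b volume
  have hvolF : volume (ZSpan.fundamentalDomain b) = 1 := by
    simp [b, ZSpan.fundamentalDomain_pi_basisFun, Real.volume_pi_Ico]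
  have : Countable (Submodule.span ℤ (Set.range b)).toAddSubgroup :=
    inferInstanceAs (Countable (Submodule.span ℤ (Set.range b)))
  obtain ⟨x, hx0, hxs⟩ := exists_ne_zero_mem_lattice_of_measure_mul_two_pow_lt_measure
    (L := (Submodule.span ℤ (Set.range b)).toAddSubgroup)
    (s := (Matrix.toLin' B) ⁻¹' (Metric.ball 0 ρ)) hfund
    (by intro x hx; simpa [Matrix.mulVec_neg] using hx)
    ((convex_ball (0 : Fin k → ℝ) ρ).linear_preimage (Matrix.toLin' B))
    (by
      rw [hvolF, one_mul, Measure.addHaar_preimage_linearMap _ hdetL, Real.volume_pi_ball _ hρ0,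
        LinearMap.det_toLin', ← ENNReal.ofReal_mul (abs_nonneg _), mul_pow, Fintype.card_fin, hρk,
        abs_inv, Module.finrank_fin_fun,
        show |B.det|⁻¹ * (2 ^ k * (2 ^ k * |B.det|)) = (2 : ℝ) ^ k * 2 ^ k by field_simp,
        show (2 : ENNReal) ^ k = ENNReal.ofReal (2 ^ k) by
          rw [ENNReal.ofReal_pow (by norm_num)]; norm_num]
      rw [ENNReal.ofReal_lt_ofReal_iff (by positivity)]
      have : (1 : ℝ) < 2 ^ k := one_lt_pow₀ (by norm_num) hk.ne'
      nlinarith)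
  have hmem := (b.mem_span_iff_repr_mem ℤ (x : Fin k → ℝ)).1 x.2
  choose z hz using hmem
  have hzx : (fun j => (z j : ℝ)) = (x : Fin k → ℝ) := by
    ext j
    have := hz j
    simpa [b] using this
  refine ⟨z, ?_, fun i => ?_⟩
  · rintro rfl
    apply hx0
    ext j
    rw [← hzx]; simp
  · rw [hzx]
    have h1 : ‖Matrix.toLin' B (x : Fin k → ℝ)‖ < ρ := by simpa using hxs
    have h2 := norm_le_pi_norm (Matrix.toLin' B (x : Fin k → ℝ)) i
    rw [Real.norm_eq_abs] at h2
    exact (by simpa using h2.trans h1.le)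

open scoped MatrixOrder ComplexOrder in
theorem exists_conjTranspose_mul_self {k : ℕ} {A : Matrix (Fin k) (Fin k) ℝ} (hA : A.PosDef) :
    ∃ B : Matrix (Fin k) (Fin k) ℝ, A = B.conjTranspose * B := by
  refine ⟨CFC.sqrt A, ?_⟩
  have h1 : (CFC.sqrt A).conjTranspose = CFC.sqrt A :=
    (Matrix.nonneg_iff_posSemidef.1 (CFC.sqrt_nonneg A)).1
  rw [h1, CFC.sqrt_mul_sqrt_self A (Matrix.nonneg_iff_posSemidef.2 hA.posSemidef)]

theorem latticeMin_le {k : ℕ} {A : Matrix (Fin k) (Fin k) ℝ} (hA : A.PosDef) {z : Fin k → ℤ}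
    (hz : z ≠ 0) :
    latticeMin A ≤ (fun i => (z i : ℝ)) ⬝ᵥ (A.mulVec (fun i => (z i : ℝ))) := by
  refine csInf_le ⟨0, ?_⟩ ⟨z, hz, rfl⟩
  rintro v ⟨z, _, rfl⟩
  exact form_nonneg hA _

theorem le_latticeMin {k : ℕ} (hk : 0 < k) {A : Matrix (Fin k) (Fin k) ℝ} {Y : ℝ}
    (h : ∀ z : Fin k → ℤ, z ≠ 0 → Y ≤ (fun i => (z i : ℝ)) ⬝ᵥ (A.mulVec (fun i => (z i : ℝ)))) :
    Y ≤ latticeMin A := by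
  refine le_csInf ⟨_, Function.const _ 1, ?_, rfl⟩ ?_
  · intro h0
    simpa using congrFun h0 ⟨0, hk⟩
  · rintro v ⟨z, hz, rfl⟩
    exact h z hz

/-- Boundedness is what makes the supremum meaningful: a real `sSup` of an unbounded set would be 0.
A small vector from `exists_int_small`, applied to B with A = BᵀB, gives the bound 4k. -/
theorem bddAbove_hermite {k : ℕ} (hk : 0 < k) :
    BddAbove {v : ℝ | ∃ A : Matrix (Fin k) (Fin k) ℝ, A.PosDef ∧
      v = latticeMin A / A.det ^ (1 / (k : ℝ))} := by
  refine ⟨k * 4, ?_⟩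
  rintro v ⟨A, hA, rfl⟩
  obtain ⟨B, hB⟩ := exists_conjTranspose_mul_self hA
  have hdet : A.det = |B.det| ^ 2 := by
    rw [hB, Matrix.det_mul, Matrix.det_conjTranspose, sq_abs]
    simp [sq]
  have hAdet := hA.det_pos
  have hB0 : B.det ≠ 0 := by
    intro h; rw [hdet, h] at hAdet; simp at hAdet
  obtain ⟨z, hz, hzB⟩ := exists_int_small hk B hB0
  rw [div_le_iff₀ (by positivity)]
  refine (latticeMin_le hA hz).trans ?_
  rw [hB, dotProduct_mulVec_conjTranspose_mul, ← hB, hdet]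
  have h1 : (|B.det| ^ 2) ^ (1 / (k : ℝ)) = (|B.det| ^ (1 / (k : ℝ))) ^ 2 := by
    rw [← Real.rpow_natCast, ← Real.rpow_natCast, ← Real.rpow_mul (abs_nonneg _),
      ← Real.rpow_mul (abs_nonneg _), mul_comm]
  rw [h1]
  calc ∑ i, (B.mulVec (fun j => (z j : ℝ)) i) ^ 2
      ≤ ∑ _i : Fin k, (2 * |B.det| ^ (1 / (k : ℝ))) ^ 2 := by
        refine Finset.sum_le_sum fun i _ => ?_
        rw [← sq_abs]
        exact pow_le_pow_left₀ (abs_nonneg _) (hzB i) 2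
    _ = _ := by rw [Finset.sum_const, Finset.card_univ, Fintype.card_fin, nsmul_eq_mul]; ring

theorem le_hermiteConst {k : ℕ} (hk : 0 < k) {A : Matrix (Fin k) (Fin k) ℝ} (hA : A.PosDef)
    {Y : ℝ}
    (h : ∀ z : Fin k → ℤ, z ≠ 0 → Y ≤ (fun i => (z i : ℝ)) ⬝ᵥ (A.mulVec (fun i => (z i : ℝ)))) :
    Y / A.det ^ (1 / (k : ℝ)) ≤ hermiteConst k := by
  refine le_trans ?_ (le_csSup (bddAbove_hermite hk) ⟨A, hA, rfl⟩)
  have := hA.det_pos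
  gcongr
  exact le_latticeMin hk h

/-- Witnessed by the lattice of integer vectors; this supplies the positivity of γ and of C_r. -/
theorem one_le_hermiteConst {k : ℕ} (hk : 0 < k) : 1 ≤ hermiteConst k := by
  have h := le_hermiteConst hk (A := (1 : Matrix (Fin k) (Fin k) ℝ)) Matrix.PosDef.one (Y := 1) ?_
  · simpa using h
  · intro z hz
    obtain ⟨i, hi⟩ := Function.ne_iff.1 hz
    rw [Matrix.one_mulVec, dotProduct]
    have h1 : (1 : ℝ) ≤ (z i : ℝ) * z i := by
      have : (1 : ℤ) ≤ z i * z i := by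
        have : 0 < z i * z i := mul_self_pos.2 (by simpa using hi)
        omega
      exact_mod_cast this
    exact h1.trans (Finset.single_le_sum (f := fun i => (z i : ℝ) * z i)
      (fun i _ => mul_self_nonneg _) (Finset.mem_univ i))

/-- A primitive integer vector is the first row of the inverse of a unimodular matrix. -/
theorem exists_unimodular_completion {k : ℕ} {w : Fin (k + 1) → ℤ} (hw : w ≠ 0) :
    ∃ (g : ℤ) (w' : Fin (k + 1) → ℤ) (V : Matrix (Fin (k + 1)) (Fin (k + 1)) ℤ),
      g ≠ 0 ∧ w = g • w' ∧ V.det ^ 2 = 1 ∧ Matrix.vecMul w' V = Pi.single 0 1 := by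
  classical
  let φ : (Fin (k + 1) → ℤ) →ₗ[ℤ] ℤ := Fintype.linearCombination ℤ w
  have hφ : ∀ z, φ z = ∑ i, z i * w i := fun z => by
    simp [φ, Fintype.linearCombination_apply]
  -- The generator g of the ideal of all products z·w is the gcd of the entries, and w' = w/g is
  -- primitive.
  obtain ⟨g, hg⟩ := (IsPrincipalIdealRing.principal (LinearMap.range φ : Ideal ℤ)).principal
  have hmem : ∀ i, ∃ c, w i = g * c := by
    intro i
    have h1 : w i ∈ LinearMap.range φ := ⟨Pi.single i 1, by simp [hφ, Pi.single_apply]⟩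
    rw [hg] at h1
    obtain ⟨c, hc⟩ := Submodule.mem_span_singleton.1 h1
    exact ⟨c, by rw [← hc, smul_eq_mul, mul_comm]⟩
  choose w' hw' using hmem
  have hwg : w = g • w' := by ext i; simp [hw' i]
  have hg0 : g ≠ 0 := by
    rintro rfl
    exact hw (by rw [hwg, zero_smul])
  obtain ⟨v, hv⟩ : ∃ v, φ v = g := by
    have : g ∈ LinearMap.range φ := by rw [hg]; exact Submodule.mem_span_singleton_self g
    exact this
  let ψ : (Fin (k + 1) → ℤ) →ₗ[ℤ] ℤ := Fintype.linearCombination ℤ w'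
  have hψ : ∀ z, ψ z = ∑ i, z i * w' i := fun z => by
    simp [ψ, Fintype.linearCombination_apply]
  have hφψ : ∀ z, φ z = g * ψ z := by
    intro z
    rw [hφ, hψ, Finset.mul_sum]
    exact Finset.sum_congr rfl fun i _ => by rw [hw' i]; ring
  have hv1 : ψ v = 1 := by
    have := hφψ v
    rw [hv] at this
    exact mul_left_cancel₀ hg0 (by rw [← this, mul_one])
  obtain ⟨n, ⟨b⟩⟩ := Submodule.nonempty_basis_of_pid (Pi.basisFun ℤ (Fin (k + 1)))
    (LinearMap.ker ψ)
  -- As ψ v = 1, the integer vectors split as ℤv ⊕ ker ψ. With v listed first, ψ reads off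
  -- coordinate 0, so w'V is the first unit vector.
  let b' := Module.Basis.mkFinCons v b
    (by
      intro c x hx h
      have := congrArg ψ h
      rw [map_add, map_smul, hv1, LinearMap.mem_ker.1 hx] at this
      simpa using this)
    (by
      intro z
      refine ⟨-ψ z, ?_⟩
      rw [LinearMap.mem_ker, map_add, map_smul, hv1]
      simp)
  have hn : n = k := by
    have h1 := Module.finrank_eq_card_basis b'
    have h2 := Module.finrank_eq_card_basis (Pi.basisFun ℤ (Fin (k + 1)))
    rw [h2, Fintype.card_fin, Fintype.card_fin] at h1
    omega
  subst hn
  let V := (Pi.basisFun ℤ (Fin (n + 1))).toMatrix b'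
  have hVb : ∀ i j, V i j = b' j i := fun i j => by simp [V, Module.Basis.toMatrix_apply]
  refine ⟨g, w', V, hg0, hwg, ?_, ?_⟩
  · have h1 := (Pi.basisFun ℤ (Fin (n + 1))).toMatrix_mul_toMatrix_flip b'
    have h2 := congrArg Matrix.det h1
    rw [Matrix.det_mul, Matrix.det_one] at h2
    rcases Int.isUnit_iff.1 (IsUnit.of_mul_eq_one _ h2) with h | h
    · show V.det ^ 2 = 1
      rw [h]; norm_num
    · show V.det ^ 2 = 1
      rw [h]; norm_num
  · ext j
    have h1 : Matrix.vecMul w' V j = ψ (b' j) := by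
      rw [hψ, Matrix.vecMul, dotProduct]
      exact Finset.sum_congr rfl fun i _ => by rw [hVb]; ring
    rw [h1]
    have hb' : b' j = Fin.cons (α := fun _ => Fin (n + 1) → ℤ) v (Subtype.val ∘ b) j := by
      rw [← Module.Basis.coe_mkFinCons]
    rw [hb']
    refine Fin.cases ?_ (fun i => ?_) j
    · simp [hv1]
    · have : ψ (b i) = 0 := LinearMap.mem_ker.1 (b i).2
      simp [this, Fin.succ_ne_zero]

/-- Hermite's inequality for the lattice of integer vectors orthogonal to `w`. -/
theorem pow_le_hermiteConst_pow_mul {k : ℕ} (hk : 0 < k) {w : Fin (k + 1) → ℤ} (hw : w ≠ 0)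
    {Y : ℝ} (hY : 0 ≤ Y)
    (h : ∀ z : Fin (k + 1) → ℤ, z ≠ 0 → ∑ i, z i * w i = 0 → Y ≤ ∑ i, (z i : ℝ) ^ 2) :
    Y ^ k ≤ hermiteConst k ^ k * ∑ i, (w i : ℝ) ^ 2 := by
  classical
  obtain ⟨g, w', V, hg0, hwg, hV, hw'V⟩ := exists_unimodular_completion hw
  have hV0 : V.det ≠ 0 := by intro h0; rw [h0] at hV; norm_num at hV
  let R : Matrix (Fin (k + 1)) (Fin (k + 1)) ℝ := V.map (Int.cast : ℤ → ℝ)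
  have hRdet : R.det = (V.det : ℝ) := by
    simpa [R] using (Int.cast_det V (R := ℝ)).symm
  have hRV : R.det ^ 2 = 1 := by rw [hRdet]; exact_mod_cast hV
  have hR0 : R.det ≠ 0 := by rw [hRdet]; exact_mod_cast hV0
  have hpos : (R.conjTranspose * R).PosDef :=
    Matrix.PosDef.conjTranspose_mul_self R (Matrix.mulVec_injective_iff_isUnit.2
      ((Matrix.isUnit_iff_isUnit_det R).2 hR0.isUnit))
  have hw'R : Matrix.vecMul (fun i => (w' i : ℝ)) R = Pi.single 0 1 := by
    ext j
    have h1 := congrFun hw'V j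
    rw [Matrix.vecMul, dotProduct] at h1 ⊢
    have h2 := congrArg (Int.cast : ℤ → ℝ) h1
    push_cast at h2
    simp only [R, Matrix.map_apply]
    rw [h2, Pi.single_apply, Pi.single_apply]
    split_ifs <;> simp
  have hadj : ∀ j, R.adjugate 0 j = R.det * w' j := by
    intro j
    have h1 := congrArg (fun u => Matrix.vecMul u R.adjugate) hw'R
    simp only [Matrix.vecMul_vecMul, Matrix.mul_adjugate] at h1
    have h2 := congrFun h1 j
    simpa [Matrix.vecMul_smul, Matrix.single_one_vecMul] using h2.symm
  -- Columns 1, …, k of V form a basis of the lattice orthogonal to w; A is its Gram matrix.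
  set A : Matrix (Fin k) (Fin k) ℝ := (R.conjTranspose * R).submatrix Fin.succ Fin.succ with hA
  have hApos : A.PosDef := hpos.submatrix (Fin.succ_injective k)
  -- This minor of RᵀR is the (0,0) entry of its adjugate, the squared norm of row 0 of adj R. By
  -- `hadj` that row is det R · w', with det R = ±1.
  have hAdet : A.det = ∑ i, (w' i : ℝ) ^ 2 := by
    have h1 := Matrix.adjugate_fin_succ_eq_det_submatrix (R.conjTranspose * R) 0 0
    simp only [Fin.val_zero, add_zero, pow_zero, one_mul] at h1
    have h2 : A.det = (R.conjTranspose * R).adjugate 0 0 := by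
      rw [h1, hA]
      congr 1
    rw [h2, Matrix.adjugate_mul_distrib, Matrix.mul_apply,
      Matrix.conjTranspose_eq_transpose_of_trivial, ← Matrix.adjugate_transpose]
    refine Finset.sum_congr rfl fun j _ => ?_
    rw [Matrix.transpose_apply, hadj j]
    linear_combination (w' j : ℝ) ^ 2 * hRV
  have hmin := le_hermiteConst hk hApos (Y := Y) ?_
  · have hAp := hApos.det_pos
    rw [div_le_iff₀ (by positivity)] at hmin
    calc Y ^ k ≤ (hermiteConst k * A.det ^ (1 / (k : ℝ))) ^ k := by gcongr
      _ = hermiteConst k ^ k * A.det := by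
        rw [mul_pow, ← Real.rpow_natCast (A.det ^ (1 / (k : ℝ))), ← Real.rpow_mul hAp.le,
          one_div_mul_cancel (by exact_mod_cast hk.ne'), Real.rpow_one]
      _ ≤ _ := by
        rw [hAdet]
        have : 0 ≤ hermiteConst k := zero_le_one.trans (one_le_hermiteConst hk)
        refine mul_le_mul_of_nonneg_left (Finset.sum_le_sum fun i _ => ?_) (by positivity)
        rw [hwg]
        have h1 : (1 : ℝ) ≤ (g : ℝ) ^ 2 := by
          have : 0 < g ^ 2 := by positivity
          exact_mod_cast this
        simp only [Pi.smul_apply, smul_eq_mul]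
        push_cast
        nlinarith [sq_nonneg (w' i : ℝ)]
  · intro z hz
    let z' : Fin (k + 1) → ℤ := Fin.cons 0 z
    let x : Fin (k + 1) → ℤ := V.mulVec z'
    have hx0 : x ≠ 0 := by
      intro h0
      have h1 := Matrix.eq_zero_of_mulVec_eq_zero hV0 h0
      apply hz
      ext i
      simpa [z'] using congrFun h1 i.succ
    have hxw : ∑ i, x i * w i = 0 := by
      have h1 : w' ⬝ᵥ x = 0 := by
        rw [Matrix.dotProduct_mulVec, hw'V]
        simp [z']
      rw [dotProduct] at h1
      rw [hwg]
      simp only [Pi.smul_apply, smul_eq_mul]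
      calc ∑ i, x i * (g * w' i) = g * ∑ i, w' i * x i := by
            rw [Finset.mul_sum]; exact Finset.sum_congr rfl fun i _ => by ring
        _ = 0 := by rw [h1, mul_zero]
    have hx := h x hx0 hxw
    refine hx.trans (le_of_eq ?_)
    have h2 : (fun i => (z i : ℝ)) ⬝ᵥ (A.mulVec (fun i => (z i : ℝ))) =
        (fun i => (z' i : ℝ)) ⬝ᵥ ((R.conjTranspose * R).mulVec (fun i => (z' i : ℝ))) := by
      simp [dotProduct, Matrix.mulVec, Fin.sum_univ_succ, z', hA]
    rw [h2, dotProduct_mulVec_conjTranspose_mul]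
    refine Finset.sum_congr rfl fun i _ => ?_
    congr 1
    simp [x, R, Matrix.mulVec, dotProduct]

/-! ### Quadratic lower bounds for 1 - cos. -/

theorem eight_mul_sq_le_one_sub_cos {x : ℝ} (hx : |x| ≤ 1 / 2) :
    8 * x ^ 2 ≤ 1 - Real.cos (2 * Real.pi * x) := by
  have h := Real.cos_le_one_sub_mul_cos_sq (x := 2 * Real.pi * x) (by
    rw [abs_mul, abs_of_pos (by positivity)]
    nlinarith [Real.pi_pos])
  have h1 : 2 / Real.pi ^ 2 * (2 * Real.pi * x) ^ 2 = 8 * x ^ 2 := by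
    field_simp; ring
  linarith

/-- By concavity sin lies above its chord on [0, π/4], and 1 - cos 2πx = 2 sin² πx. The restricted
range doubles the constant 8. -/
theorem sixteen_mul_sq_le_one_sub_cos {x : ℝ} (hx : |x| ≤ 1 / 4) :
    16 * x ^ 2 ≤ 1 - Real.cos (2 * Real.pi * x) := by
  wlog h0 : 0 ≤ x generalizing x
  · have := this (x := -x) (by rwa [abs_neg]) (by linarith)
    simpa using this
  rw [abs_of_nonneg h0] at hx
  have m1 : Real.pi / 4 ∈ Set.Icc 0 Real.pi := ⟨by positivity, by linarith [Real.pi_pos]⟩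
  have m2 : (0 : ℝ) ∈ Set.Icc 0 Real.pi := ⟨le_rfl, Real.pi_pos.le⟩
  have hc := strictConcaveOn_sin_Icc.concaveOn.2 m1 m2
    (by linarith : 0 ≤ 4 * x) (by linarith : 0 ≤ 1 - 4 * x) (by ring)
  simp only [smul_eq_mul, Real.sin_pi_div_four, Real.sin_zero, mul_zero, add_zero] at hc
  rw [show 4 * x * (Real.pi / 4) = Real.pi * x by ring] at hc
  have h2 : (4 * x * (√2 / 2)) ^ 2 ≤ Real.sin (Real.pi * x) ^ 2 :=
    pow_le_pow_left₀ (by positivity) hc 2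
  have h3 : (4 * x * (√2 / 2)) ^ 2 = 8 * x ^ 2 := by
    rw [mul_pow, div_pow, Real.sq_sqrt (by norm_num)]; ring
  have h4 : Real.cos (2 * Real.pi * x) = 1 - 2 * Real.sin (Real.pi * x) ^ 2 := by
    rw [mul_assoc, Real.cos_two_mul, Real.cos_sq']; ring
  rw [h4]; linarith

theorem abs_lt_quarter_of_one_sub_cos_lt {x : ℝ} (hx : |x| ≤ 1 / 2)
    (h : 1 - Real.cos (2 * Real.pi * x) < 1) : |x| < 1 / 4 := by
  by_contra hcon
  push Not at hcon
  have h1 : Real.cos (2 * Real.pi * |x|) ≤ 0 :=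
    Real.cos_nonpos_of_pi_div_two_le_of_le (by nlinarith [Real.pi_pos])
      (by nlinarith [Real.pi_pos])
  have h2 : Real.cos (2 * Real.pi * |x|) = Real.cos (2 * Real.pi * x) := by
    rcases abs_choice x with h | h <;> rw [h]
    rw [mul_neg, Real.cos_neg]
  linarith

/-! ### Integer recurrences for least residues. -/

/-- The shift operator on rational sequences. -/
def shiftMap : Module.End ℚ (ℕ → ℚ) where
  toFun u := fun j => u (j + 1)
  map_add' _ _ := rfl
  map_smul' _ _ := rfl

theorem shiftMap_pow_apply (i : ℕ) (u : ℕ → ℚ) (j : ℕ) : (shiftMap ^ i) u j = u (i + j) := by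
  induction i generalizing j with
  | zero => simp
  | succ i ih =>
    rw [pow_succ', Module.End.mul_apply]
    show (shiftMap ^ i) u (j + 1) = _
    rw [ih]; congr 1; ring

theorem aeval_shiftMap_apply (P : ℚ[X]) {n : ℕ} (hn : P.natDegree < n) (u : ℕ → ℚ) (j : ℕ) :
    (aeval shiftMap P) u j = ∑ i ∈ Finset.range n, P.coeff i * u (i + j) := by
  rw [aeval_eq_sum_range' hn, LinearMap.sum_apply, Finset.sum_apply]
  exact Finset.sum_congr rfl fun i _ => by
    rw [LinearMap.smul_apply, Pi.smul_apply, shiftMap_pow_apply, smul_eq_mul]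

/-- No nontrivial integer recurrence of order `≤ φ(t)` annihilates the sequence of least residues
of `a g ^ j`, where `g` has order `t`. -/
theorem exists_recurrence_ne_zero {p t r : ℕ} [Fact p.Prime] (ht : 0 < t)
    {g a : ZMod p} (hg : orderOf g = t) (ha : a ≠ 0) (hr : r ≤ t.totient)
    {z : Fin r → ℤ} (hz : z ≠ 0) :
    ∃ j : ℕ, ∑ i : Fin r, z i * (a * g ^ ((i : ℕ) + j)).valMinAbs ≠ 0 := by
  classical
  by_contra hcon
  push Not at hcon
  let b : ℕ → ℤ := fun j => (a * g ^ j).valMinAbs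
  let u : ℕ → ℚ := fun j => b j
  let f : ℚ[X] := ∑ i : Fin r, C (z i : ℚ) * X ^ (i : ℕ)
  have hfcoeff : ∀ i : Fin r, f.coeff i = z i := by
    intro i
    simp only [f, finsetSum_coeff, coeff_C_mul, coeff_X_pow]
    rw [Finset.sum_eq_single i]
    · simp
    · intro j _ hj
      rw [if_neg (fun h => hj (Fin.ext h.symm)), mul_zero]
    · simp
  have hf0 : f ≠ 0 := by
    obtain ⟨i, hi⟩ := Function.ne_iff.1 hz
    intro h
    have := hfcoeff i
    rw [h, coeff_zero] at this
    exact hi (by exact_mod_cast this.symm)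
  have hfdeg : f.degree < r := by
    refine (degree_sum_le _ _).trans_lt ((Finset.sup_lt_iff (by simp)).2 fun i _ => ?_)
    exact (degree_C_mul_X_pow_le _ _).trans_lt (by exact_mod_cast i.2)
  have hfnat : f.natDegree < r := (natDegree_lt_iff_degree_lt hf0).2 hfdeg
  have hfu : aeval shiftMap f u = 0 := by
    ext j
    rw [aeval_shiftMap_apply f hfnat, ← Fin.sum_univ_eq_sum_range (fun i => f.coeff i * u (i + j)),
      Pi.zero_apply]
    have := hcon j
    simp only [hfcoeff, u, b]
    exact_mod_cast this
  have hirr := cyclotomic.irreducible_rat ht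
  -- Degree f < r ≤ φ(t), so the irreducible Φ_t cannot divide f.
  have hcop : IsCoprime f (cyclotomic t ℚ) := by
    refine ((hirr.coprime_iff_not_dvd).2 fun hdvd => ?_).symm
    have h1 := natDegree_le_of_dvd hdvd hf0
    rw [natDegree_cyclotomic] at h1
    omega
  let Ψ : ℤ[X] := ∏ i ∈ t.properDivisors, cyclotomic i ℤ
  have hΨ : Ψ * cyclotomic t ℤ = X ^ t - 1 := by
    rw [← prod_cyclotomic_eq_X_pow_sub_one ht, ← Nat.cons_self_properDivisors ht.ne',
      Finset.prod_cons, mul_comm]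
  have hXu : aeval shiftMap (X ^ t - 1 : ℚ[X]) u = 0 := by
    ext j
    simp only [map_sub, map_pow, aeval_X, map_one, LinearMap.sub_apply, Module.End.one_apply,
      Pi.sub_apply, shiftMap_pow_apply, Pi.zero_apply, u, b]
    rw [pow_add, ← hg, pow_orderOf_eq_one, one_mul, sub_self]
  -- Both f and X^t - 1 = ΨΦ_t annihilate u, hence so does Ψ by Bézout. Reduced mod p at index 0
  -- this gives Ψ(g) = 0, so g is a root of some Φ_m with m a proper divisor of t, against its
  -- order.
  have hΨu : aeval shiftMap (Ψ.map (Int.castRingHom ℚ)) u = 0 := by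
    obtain ⟨c, e, hce⟩ := hcop
    have h1 : Ψ.map (Int.castRingHom ℚ) =
        (Ψ.map (Int.castRingHom ℚ) * c) * f + e * (X ^ t - 1) := by
      have h2 : (X ^ t - 1 : ℚ[X]) = Ψ.map (Int.castRingHom ℚ) * cyclotomic t ℚ := by
        have := congrArg (Polynomial.map (Int.castRingHom ℚ)) hΨ
        simpa using this.symm
      rw [h2]
      linear_combination (-Ψ.map (Int.castRingHom ℚ)) * hce
    rw [h1, map_add, map_mul _ _ f, map_mul _ e, LinearMap.add_apply, Module.End.mul_apply,
      Module.End.mul_apply, hfu, hXu, map_zero, map_zero, add_zero]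
  have hΨg : (Ψ.map (Int.castRingHom (ZMod p))).eval g = 0 := by
    have h1 := congrFun hΨu 0
    rw [aeval_shiftMap_apply _ (Nat.lt_succ_self _), Pi.zero_apply] at h1
    simp only [coeff_map, u, eq_intCast, add_zero] at h1
    have h2 : ∑ i ∈ Finset.range ((Ψ.map (Int.castRingHom ℚ)).natDegree + 1),
        Ψ.coeff i * b i = 0 := by exact_mod_cast h1
    have h3 := congrArg (Int.cast : ℤ → ZMod p) h2
    push_cast at h3
    simp only [b, ZMod.coe_valMinAbs] at h3
    rw [natDegree_map_eq_of_injective (RingHom.injective_int _)] at h3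
    have h4 : a * (Ψ.map (Int.castRingHom (ZMod p))).eval g = 0 := by
      rw [eval_map, eval₂_eq_sum_range, Finset.mul_sum, ← h3]
      exact Finset.sum_congr rfl fun i _ => by rw [eq_intCast]; ring
    exact (mul_eq_zero.1 h4).resolve_left ha
  rw [Polynomial.map_prod, eval_prod, Finset.prod_eq_zero_iff] at hΨg
  obtain ⟨m, hm, hmg⟩ := hΨg
  rw [map_cyclotomic] at hmg
  have hmt := Nat.mem_properDivisors.1 hm
  have hmpos : 0 < m := Nat.pos_of_dvd_of_pos hmt.1 ht
  have hgm : g ^ m = 1 := by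
    have h1 : (X ^ m - 1 : (ZMod p)[X]).eval g = 0 := by
      rw [← prod_cyclotomic_eq_X_pow_sub_one hmpos, eval_prod]
      exact Finset.prod_eq_zero (Nat.mem_divisors_self m hmpos.ne') hmg
    simpa [sub_eq_zero] using h1
  have := orderOf_le_of_pow_eq_one hmpos hgm
  omega

/-! ### Lower bound for the deficiency. -/

theorem sum_rootsMod_eq_sum_range {p t : ℕ} [Fact p.Prime] (hcard : (rootsMod p t).card = t)
    {g : ZMod p} (hg : orderOf g = t) {M : Type*} [AddCommMonoid M] (f : ZMod p → M) :
    ∑ h ∈ rootsMod p t, f h = ∑ j ∈ Finset.range t, f (g ^ j) := by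
  classical
  have hinj : Set.InjOn (fun j => g ^ j) (Finset.range t) := by
    rw [← hg]
    intro i hi j hj h
    exact pow_injOn_Iio_orderOf (by simpa using hi) (by simpa using hj) h
  rw [← Finset.sum_image (f := f) hinj]
  refine Finset.sum_congr (Finset.eq_of_subset_of_card_le ?_ ?_).symm fun _ _ => rfl
  · intro x hx
    obtain ⟨j, _, rfl⟩ := Finset.mem_image.1 hx
    simp only [rootsMod, Finset.mem_filter, Finset.mem_univ, true_and]
    rw [← pow_mul, mul_comm, pow_mul, ← hg, pow_orderOf_eq_one, one_pow]
  · rw [hcard, Finset.card_image_of_injOn hinj, Finset.card_range]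

theorem sum_range_shift {p t : ℕ} [Fact p.Prime] (ht : 0 < t) (hcard : (rootsMod p t).card = t)
    {g : ZMod p} (hg : orderOf g = t) (f : ZMod p → ℝ) (i : ℕ) :
    ∑ j ∈ Finset.range t, f (g ^ (i + j)) = ∑ h ∈ rootsMod p t, f h := by
  have hgi : g ^ i ∈ rootsMod p t := by
    simp only [rootsMod, Finset.mem_filter, Finset.mem_univ, true_and]
    rw [← pow_mul, mul_comm, pow_mul, ← hg, pow_orderOf_eq_one, one_pow]
  rw [← sum_rootsMod_mul ht f hgi, sum_rootsMod_eq_sum_range hcard hg]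
  exact Finset.sum_congr rfl fun j _ => by rw [pow_add]

theorem abs_valMinAbs_div_le {p : ℕ} [NeZero p] (x : ZMod p) : |(x.valMinAbs : ℝ) / p| ≤ 1 / 2 := by
  have hp : (0 : ℝ) < p := by exact_mod_cast Nat.pos_of_ne_zero (NeZero.ne p)
  rw [abs_div, abs_of_pos hp, div_le_iff₀ hp]
  have h1 := ZMod.natAbs_valMinAbs_le x
  have h2 : 2 * x.valMinAbs.natAbs ≤ p := by omega
  have h3 : (2 : ℝ) * |(x.valMinAbs : ℝ)| ≤ p := by
    rw [← Int.cast_abs, Int.abs_eq_natAbs]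
    exact_mod_cast h2
  linarith

/-- A relation among a window of consecutive residues gives a long vector. -/
theorem eight_le_norm_sq_mul_deficiency {p t r : ℕ} [Fact p.Prime] (ht : 0 < t)
    (hcard : (rootsMod p t).card = t) {g a : ZMod p} (hg : orderOf g = t) (ha : a ≠ 0)
    (hr : r ≤ t.totient) {z : Fin r → ℤ} (hz : z ≠ 0) {j₀ : ℕ}
    (hz0 : ∑ i : Fin r, z i * (a * g ^ ((i : ℕ) + j₀)).valMinAbs = 0) :
    8 ≤ (∑ i, (z i : ℝ) ^ 2) * deficiency p t a := by
  have hp : (0 : ℝ) < p := by exact_mod_cast (Fact.out : p.Prime).pos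
  have hg0 : g ≠ 0 := by
    rintro rfl
    rw [orderOf_zero] at hg
    omega
  obtain ⟨j, hj⟩ := exists_recurrence_ne_zero ht hg ha hr hz
  set c := ∑ i : Fin r, z i * (a * g ^ ((i : ℕ) + j)).valMinAbs with hc
  have hfg : ∑ i : Fin r, (z i : ZMod p) * g ^ (i : ℕ) = 0 := by
    have h1 := congrArg (Int.cast : ℤ → ZMod p) hz0
    push_cast at h1
    have h2 : (a * g ^ j₀) * ∑ i : Fin r, (z i : ZMod p) * g ^ (i : ℕ) = 0 := by
      rw [Finset.mul_sum, ← h1]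
      exact Finset.sum_congr rfl fun i _ => by rw [pow_add]; ring
    exact (mul_eq_zero.1 h2).resolve_left (mul_ne_zero ha (pow_ne_zero _ hg0))
  -- The relation at one window holds mod p at every shift, so the nonzero integer c has absolute
  -- value at least p.
  have hpc : (p : ℤ) ∣ c := by
    rw [← ZMod.intCast_zmod_eq_zero_iff_dvd, hc]
    push_cast
    calc _ = (a * g ^ j) * ∑ i : Fin r, (z i : ZMod p) * g ^ (i : ℕ) := by
          rw [Finset.mul_sum]
          exact Finset.sum_congr rfl fun i _ => by rw [pow_add]; ring
      _ = 0 := by rw [hfg, mul_zero]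
  have hcp : (p : ℝ) ^ 2 ≤ (c : ℝ) ^ 2 := by
    have h1 := Int.le_of_dvd (abs_pos.2 hj) ((dvd_abs _ _).2 hpc)
    rw [← sq_abs (c : ℝ)]
    have h2 : (p : ℝ) ≤ |(c : ℝ)| := by rw [← Int.cast_abs]; exact_mod_cast h1
    gcongr
  let x : ℕ → ℝ := fun n => ((a * g ^ n).valMinAbs : ℝ) / p
  have hcs : (c : ℝ) ^ 2 ≤ (∑ i, (z i : ℝ) ^ 2) * (p ^ 2 * ∑ i : Fin r, x ((i : ℕ) + j) ^ 2) := by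
    have h1 := Finset.sum_mul_sq_le_sq_mul_sq Finset.univ (fun i : Fin r => (z i : ℝ))
      (fun i : Fin r => ((a * g ^ ((i : ℕ) + j)).valMinAbs : ℝ))
    rw [hc]
    push_cast
    refine h1.trans (le_of_eq ?_)
    congr 1
    rw [Finset.mul_sum]
    refine Finset.sum_congr rfl fun i _ => ?_
    simp only [x]
    field_simp
  have hsum : 8 * ∑ i : Fin r, x ((i : ℕ) + j) ^ 2 ≤ deficiency p t a := by
    have hrt : r ≤ t := hr.trans (Nat.totient_le t)
    rw [deficiency, ← sum_range_shift ht hcard hg _ j, Finset.mul_sum,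
      Fin.sum_univ_eq_sum_range (fun i => 8 * x (i + j) ^ 2)]
    calc ∑ i ∈ Finset.range r, 8 * x (i + j) ^ 2 ≤ ∑ i ∈ Finset.range t, 8 * x (i + j) ^ 2 :=
          Finset.sum_le_sum_of_subset_of_nonneg (Finset.range_subset_range.2 hrt)
            fun _ _ _ => by positivity
      _ ≤ _ := by
          refine Finset.sum_le_sum fun i _ => ?_
          rw [add_comm i j]
          exact eight_mul_sq_le_one_sub_cos (abs_valMinAbs_div_le _)
  have hz2 : 0 ≤ ∑ i, (z i : ℝ) ^ 2 := by positivity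
  have h3 : (p : ℝ) ^ 2 * 8 ≤ p ^ 2 * ((∑ i, (z i : ℝ) ^ 2) * deficiency p t a) := by
    have h4 := mul_le_mul_of_nonneg_left hsum (mul_nonneg (sq_nonneg (p : ℝ)) hz2)
    nlinarith
  exact le_of_mul_le_mul_left h3 (by positivity)

/-- The lower bound for the deficiency obtained from Hermite's constant. -/
theorem le_deficiency_pow {p t r : ℕ} [Fact p.Prime] (ht : 0 < t)
    (hcard : (rootsMod p t).card = t) {g a : ZMod p} (hg : orderOf g = t) (ha : a ≠ 0)
    (hr2 : 2 ≤ r) (hr : r ≤ t.totient) (hsmall : r * deficiency p t a < t) :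
    16 * 8 ^ (r - 1) * (t : ℝ) ≤
      deficiency p t a ^ r * (p ^ 2 * (r * hermiteConst (r - 1) ^ (r - 1))) := by
  have hp : (0 : ℝ) < p := by exact_mod_cast (Fact.out : p.Prime).pos
  have ht' : (0 : ℝ) < t := by exact_mod_cast ht
  obtain ⟨k, rfl⟩ : ∃ k, r = k + 1 := ⟨r - 1, by omega⟩
  rw [Nat.add_sub_cancel]
  have hk : 0 < k := by omega
  set Δ := deficiency p t a with hΔ
  let F : ZMod p → ℝ := fun h => 1 - Real.cos (2 * Real.pi * (((a * h).valMinAbs : ℝ) / p))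
  have hF0 : ∀ h, 0 ≤ F h := fun h => by
    have := Real.cos_le_one (2 * Real.pi * (((a * h).valMinAbs : ℝ) / p))
    simp only [F]; linarith
  have hdouble : ∑ j ∈ Finset.range t, ∑ i : Fin (k + 1), F (g ^ ((i : ℕ) + j)) =
      (k + 1 : ℕ) * Δ := by
    rw [Finset.sum_comm]
    have : ∀ i : Fin (k + 1), ∑ j ∈ Finset.range t, F (g ^ ((i : ℕ) + j)) = Δ :=
      fun i => sum_range_shift ht hcard hg F i
    simp only [this]
    simp
  -- Each root lies in r of the t cyclic windows, counted by position, so some window carries at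
  -- most the average rΔ/t.
  obtain ⟨j₀, hj₀t, hj₀⟩ : ∃ j ∈ Finset.range t,
      ∑ i : Fin (k + 1), F (g ^ ((i : ℕ) + j)) ≤ (k + 1 : ℕ) * Δ / t := by
    refine Finset.exists_le_of_sum_le (Finset.nonempty_range_iff.2 ht.ne') ?_
    rw [hdouble, Finset.sum_const, Finset.card_range, nsmul_eq_mul]
    field_simp
    rfl
  have hlt : (k + 1 : ℕ) * Δ / t < 1 := by rw [div_lt_one ht']; exact hsmall
  let w : Fin (k + 1) → ℤ := fun i => (a * g ^ ((i : ℕ) + j₀)).valMinAbs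
  have hg0 : g ≠ 0 := by
    rintro rfl
    rw [orderOf_zero] at hg
    omega
  have hw : w ≠ 0 := by
    intro h
    have := congrFun h 0
    simp only [w, Pi.zero_apply, ZMod.valMinAbs_eq_zero] at this
    exact mul_ne_zero ha (pow_ne_zero _ hg0) this
  have hwsq : 16 * ∑ i, (w i : ℝ) ^ 2 ≤ p ^ 2 * ((k + 1 : ℕ) * Δ / t) := by
    refine le_trans ?_ (mul_le_mul_of_nonneg_left hj₀ (sq_nonneg (p : ℝ)))
    rw [Finset.mul_sum, Finset.mul_sum]
    refine Finset.sum_le_sum fun i _ => ?_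
    -- By `hsmall` every term of the window is below 1, so its cosine is positive and the sharper
    -- constant 16 applies.
    have h1 : F (g ^ ((i : ℕ) + j₀)) < 1 :=
      ((Finset.single_le_sum (f := fun i : Fin (k + 1) => F (g ^ ((i : ℕ) + j₀)))
        (fun i _ => hF0 _) (Finset.mem_univ i)).trans hj₀).trans_lt hlt
    have h2 := sixteen_mul_sq_le_one_sub_cos
      (abs_lt_quarter_of_one_sub_cos_lt (abs_valMinAbs_div_le _) h1).le
    have h3 := mul_le_mul_of_nonneg_left h2 (sq_nonneg (p : ℝ))
    refine le_trans (le_of_eq ?_) h3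
    simp only [w]
    field_simp
  have hΔ0 : 0 < Δ := by
    by_contra hcon
    push Not at hcon
    have h1 : (p : ℝ) ^ 2 * ((k + 1 : ℕ) * Δ / t) ≤ 0 := by
      have : ((k + 1 : ℕ) * Δ / t : ℝ) ≤ 0 :=
        div_nonpos_of_nonpos_of_nonneg (mul_nonpos_of_nonneg_of_nonpos (Nat.cast_nonneg _) hcon)
          ht'.le
      exact mul_nonpos_of_nonneg_of_nonpos (by positivity) this
    have h2 : 0 < ∑ i, (w i : ℝ) ^ 2 := by
      obtain ⟨i, hi⟩ := Function.ne_iff.1 hw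
      have hi' : (w i : ℝ) ≠ 0 := by exact_mod_cast hi
      exact (by positivity : 0 < (w i : ℝ) ^ 2).trans_le
        (Finset.single_le_sum (f := fun i => (w i : ℝ) ^ 2) (fun _ _ => by positivity)
          (Finset.mem_univ i))
    linarith
  have hmain := pow_le_hermiteConst_pow_mul hk hw (Y := 8 / Δ) (by positivity) (by
    intro z hz hz0
    rw [div_le_iff₀ hΔ0]
    exact eight_le_norm_sq_mul_deficiency ht hcard hg ha hr hz hz0)
  have hγ : 0 ≤ hermiteConst k ^ k :=
    pow_nonneg (zero_le_one.trans (one_le_hermiteConst hk)) _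
  rw [div_pow, div_le_iff₀ (by positivity)] at hmain
  have h5 : 16 * 8 ^ k ≤ hermiteConst k ^ k * (p ^ 2 * ((k + 1 : ℕ) * Δ / t)) * Δ ^ k := by
    calc (16 : ℝ) * 8 ^ k ≤ 16 * (hermiteConst k ^ k * (∑ i, (w i : ℝ) ^ 2) * Δ ^ k) := by gcongr
      _ = hermiteConst k ^ k * (16 * ∑ i, (w i : ℝ) ^ 2) * Δ ^ k := by ring
      _ ≤ _ := by gcongr
  calc 16 * 8 ^ k * (t : ℝ)
      ≤ hermiteConst k ^ k * (p ^ 2 * ((k + 1 : ℕ) * Δ / t)) * Δ ^ k * t := by gcongr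
    _ = _ := by field_simp; ring

theorem constC_pos {r : ℕ} (hr : 2 ≤ r) : 0 < constC r := by
  have h := one_le_hermiteConst (k := r - 1) (by omega)
  have : (0 : ℝ) < r := by exact_mod_cast (by omega : 0 < r)
  have : 0 < hermiteConst (r - 1) ^ (r - 1) := by positivity
  unfold constC
  positivity

theorem constC_pow_mul {r : ℕ} (hr : 2 ≤ r) :
    constC r ^ r * (r * hermiteConst (r - 1) ^ (r - 1)) = 1 := by
  have h := one_le_hermiteConst (k := r - 1) (by omega)
  have hr0 : (0 : ℝ) < r := by exact_mod_cast (by omega : 0 < r)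
  have h1 : 0 < (r : ℝ) * hermiteConst (r - 1) ^ (r - 1) := by positivity
  rw [constC, ← Real.rpow_natCast (_ ^ (-(1 / (r : ℝ)))), ← Real.rpow_mul h1.le, neg_mul,
    one_div_mul_cancel hr0.ne', Real.rpow_neg_one, inv_mul_cancel₀ h1.ne']

theorem deficiency_nonneg {p t : ℕ} [NeZero p] (b : ZMod p) : 0 ≤ deficiency p t b :=
  Finset.sum_nonneg fun _ _ => sub_nonneg.2 (Real.cos_le_one _)

/-- The uniform lower bound for the deficiency. -/
theorem le_deficiency {p t r : ℕ} [Fact p.Prime] (ht : 0 < t)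
    (hcard : (rootsMod p t).card = t) {g b : ZMod p} (hg : orderOf g = t) (hb : b ≠ 0)
    (hr2 : 2 ≤ r) (hr : r ≤ t.totient)
    (htbound : (p : ℝ) ^ (2 / (r : ℝ)) * (t : ℝ) ^ (1 - 1 / (r : ℝ)) > 32 * (r : ℝ) * constC r) :
    8 * 2 ^ (1 / (r : ℝ)) * constC r * (t : ℝ) ^ (1 / (r : ℝ)) / (p : ℝ) ^ (2 / (r : ℝ)) ≤
      deficiency p t b := by
  have hp : (0 : ℝ) < p := by exact_mod_cast (Fact.out : p.Prime).pos
  have ht' : (0 : ℝ) < t := by exact_mod_cast ht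
  have hr0 : (0 : ℝ) < r := by exact_mod_cast (by omega : 0 < r)
  have hC := constC_pos hr2
  set Δ := deficiency p t b with hΔ
  -- If rΔ < t the Hermite bound applies, with 16·8^(r-1) = 2·8^r accounting for the factor 2^(1/r).
  -- Otherwise Δ ≥ t/r, and the first hypothesis suffices because 8·2^(1/r) ≤ 16 < 32.
  rcases lt_or_ge ((r : ℝ) * Δ) t with h | h
  · have h1 := le_deficiency_pow ht hcard hg hb hr2 hr h
    refine le_of_pow_le_pow_left₀ (by omega : r ≠ 0) (deficiency_nonneg b) ?_
    rw [div_pow, mul_pow, mul_pow, mul_pow, ← Real.rpow_natCast ((2 : ℝ) ^ _),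
      ← Real.rpow_natCast ((t : ℝ) ^ _), ← Real.rpow_natCast ((p : ℝ) ^ _),
      ← Real.rpow_mul (by norm_num), ← Real.rpow_mul ht'.le, ← Real.rpow_mul hp.le,
      one_div_mul_cancel hr0.ne', div_mul_cancel₀ _ hr0.ne', Real.rpow_one, Real.rpow_one,
      Real.rpow_two, div_le_iff₀ (by positivity)]
    have h2 := constC_pow_mul hr2
    have h3 := mul_le_mul_of_nonneg_left h1 (by positivity : 0 ≤ constC r ^ r)
    have h4 : (8 : ℝ) ^ r = 8 ^ (r - 1) * 8 := by rw [← pow_succ]; congr 1; omega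
    rw [h4]
    linear_combination h3 + Δ ^ r * (p : ℝ) ^ 2 * h2
  · have h1 : (t : ℝ) / r ≤ Δ := by rw [div_le_iff₀ hr0]; linarith
    refine le_trans ?_ h1
    have hP : 0 < (p : ℝ) ^ (2 / (r : ℝ)) := by positivity
    have hT : 0 < (t : ℝ) ^ (1 / (r : ℝ)) := by positivity
    have hT2 : (t : ℝ) ^ (1 - 1 / (r : ℝ)) * (t : ℝ) ^ (1 / (r : ℝ)) = t := by
      rw [← Real.rpow_add ht', sub_add_cancel, Real.rpow_one]
    have h2 : (2 : ℝ) ^ (1 / (r : ℝ)) ≤ 2 := by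
      have : (1 : ℝ) / r ≤ 1 := by
        rw [div_le_one hr0]; exact_mod_cast (by omega : 1 ≤ r)
      simpa using Real.rpow_le_rpow_of_exponent_le (by norm_num : (1 : ℝ) ≤ 2) this
    rw [div_le_div_iff₀ hP hr0]
    have h3 : 32 * (r : ℝ) * constC r * (t : ℝ) ^ (1 / (r : ℝ)) ≤ t * (p : ℝ) ^ (2 / (r : ℝ)) := by
      calc _ ≤ (p : ℝ) ^ (2 / (r : ℝ)) * (t : ℝ) ^ (1 - 1 / (r : ℝ)) *
            (t : ℝ) ^ (1 / (r : ℝ)) := by gcongr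
        _ = _ := by rw [mul_assoc, hT2, mul_comm]
    have h4 : 0 < constC r * (t : ℝ) ^ (1 / (r : ℝ)) * r := by positivity
    have h5 := mul_le_mul_of_nonneg_right h2 h4.le
    nlinarith

/-! ### Combining the energy and lattice bounds. -/

theorem exists_orderOf_eq {p d t : ℕ} [Fact p.Prime] (hd : 0 < d) (hdt : d * t = p - 1) :
    ∃ g : ZMod p, orderOf g = t := by
  obtain ⟨g₀, hg₀⟩ := IsCyclic.exists_generator (α := (ZMod p)ˣ)
  have h1 : orderOf g₀ = p - 1 := by
    rw [orderOf_eq_card_of_forall_mem_zpowers hg₀, Nat.card_eq_fintype_card,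
      ZMod.card_units_eq_totient, Nat.totient_prime Fact.out]
  refine ⟨((g₀ ^ d : (ZMod p)ˣ) : ZMod p), ?_⟩
  rw [orderOf_units, orderOf_pow_of_dvd hd.ne' (h1 ▸ Dvd.intro _ hdt), h1, ← hdt,
    Nat.mul_div_cancel_left _ hd]

/-- A large exponential sum would contradict the energy estimate. -/
theorem norm_expSum_pow_eight_mul_le {p d t : ℕ} [Fact p.Prime] (hd : 0 < d) (ht : 0 < t)
    (hdt : d * t = p - 1) {a : ZMod p} (ha : a ≠ 0) :
    (d : ℝ) ^ 5 * ‖expSum p t a‖ ^ 8 ≤ 10 * (p : ℝ) ^ 6 := by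
  have hp1 : 1 < p := (Fact.out : p.Prime).one_lt
  have hp : (0 : ℝ) < p := by exact_mod_cast (Fact.out : p.Prime).pos
  have ht' : (0 : ℝ) < t := by exact_mod_cast ht
  have hd' : (0 : ℝ) < d := by exact_mod_cast hd
  have hcard := (rootsMod_card_and_fibre hd ht hdt).1
  have hdtp : (d : ℝ) * t ≤ p := by exact_mod_cast (by omega : d * t ≤ p)
  have hdt5 : (d : ℝ) ^ 5 * (t : ℝ) ^ 5 ≤ (p : ℝ) ^ 5 := by
    rw [← mul_pow]; gcongr
  by_contra hcon
  push Not at hcon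
  have htp : t < p := by
    have : t ≤ d * t := Nat.le_mul_of_pos_left t hd
    omega
  -- If the claim fails, the square-root bound forces d^5 > 10p², hence 10t^5 < p^3: exactly the
  -- range where the energy estimate holds.
  have h1 := norm_expSum_sq_le ht hcard ha
  have h2 : ‖expSum p t a‖ ^ 8 ≤ (p : ℝ) ^ 4 := by
    calc ‖expSum p t a‖ ^ 8 = (‖expSum p t a‖ ^ 2) ^ 4 := by ring
      _ ≤ _ := by gcongr
  have h3 : 10 * (p : ℝ) ^ 2 < (d : ℝ) ^ 5 := by
    have : 10 * (p : ℝ) ^ 6 < (d : ℝ) ^ 5 * (p : ℝ) ^ 4 := hcon.trans_le (by gcongr)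
    refine lt_of_mul_lt_mul_right ?_ (by positivity : 0 ≤ (p : ℝ) ^ 4)
    linarith [show 10 * (p : ℝ) ^ 2 * (p : ℝ) ^ 4 = 10 * (p : ℝ) ^ 6 by ring]
  have h4 : 10 * t ^ 5 < p ^ 3 := by
    have h5 : (10 * (t : ℝ) ^ 5) * (p : ℝ) ^ 2 < (p : ℝ) ^ 3 * (p : ℝ) ^ 2 := by
      have := mul_lt_mul_of_pos_right h3 (pow_pos ht' 5)
      linarith [show (p : ℝ) ^ 3 * (p : ℝ) ^ 2 = (p : ℝ) ^ 5 by ring,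
        show (10 * (t : ℝ) ^ 5) * (p : ℝ) ^ 2 = 10 * (p : ℝ) ^ 2 * (t : ℝ) ^ 5 by ring]
    have := lt_of_mul_lt_mul_right h5 (by positivity)
    exact_mod_cast this
  have h5 : (∑ u : ZMod p, (diffCount p t u : ℝ) ^ 2) ^ 2 ≤ 10 * (t : ℝ) ^ 5 := by
    exact_mod_cast energy_sq_le ht htp h4
  have h6 := norm_expSum_pow_eight_le ht hcard ha
  have h7 : (d : ℝ) ^ 5 * ‖expSum p t a‖ ^ 8 ≤ (d : ℝ) ^ 5 * (p * (10 * (t : ℝ) ^ 5)) := by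
    refine mul_le_mul_of_nonneg_left (h6.trans ?_) (by positivity)
    gcongr
  have h8 : (d : ℝ) ^ 5 * (p * (10 * (t : ℝ) ^ 5)) ≤ 10 * (p : ℝ) ^ 6 := by
    have := mul_le_mul_of_nonneg_left hdt5 (by positivity : 0 ≤ 10 * (p : ℝ))
    linarith [show (d : ℝ) ^ 5 * (p * (10 * (t : ℝ) ^ 5)) =
      10 * (p : ℝ) * ((d : ℝ) ^ 5 * (t : ℝ) ^ 5) by ring,
      show 10 * (p : ℝ) * (p : ℝ) ^ 5 = 10 * (p : ℝ) ^ 6 by ring]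
  linarith

/-- The bound for exponential sums over subgroups obtained from the geometry of numbers. -/
theorem le_sub_norm_expSum {p t : ℕ} [Fact p.Prime] (ht : 0 < t)
    (hcard : (rootsMod p t).card = t) {a : ZMod p} (ha : a ≠ 0) {δ : ℝ}
    (hδ : ∀ b : ZMod p, b ≠ 0 → δ ≤ deficiency p t b) :
    (1 - 1 / (t : ℝ)) * δ / 2 ≤ t - ‖expSum p t a‖ := by
  classical
  have ht' : (0 : ℝ) < t := by exact_mod_cast ht
  have ht1 : (1 : ℝ) ≤ t := by exact_mod_cast ht
  have h1 := sq_sub_norm_sq_expSum ht hcard a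
  have hone : (1 : ZMod p) ∈ rootsMod p t := by simp [rootsMod]
  have h2 : ((t : ℝ) - 1) * δ ≤ (t : ℝ) ^ 2 - ‖expSum p t a‖ ^ 2 := by
    rw [h1, ← Finset.add_sum_erase _ _ hone]
    have h3 : ∑ k ∈ (rootsMod p t).erase 1, δ ≤
        ∑ k ∈ (rootsMod p t).erase 1, deficiency p t (a * (k - 1)) :=
      Finset.sum_le_sum fun k hk =>
        hδ _ (mul_ne_zero ha (sub_ne_zero.2 (Finset.mem_erase.1 hk).1))
    rw [Finset.sum_const, Finset.card_erase_of_mem hone, hcard, nsmul_eq_mul,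
      Nat.cast_sub ht, Nat.cast_one] at h3
    have := deficiency_nonneg (p := p) (t := t) (a * (1 - 1))
    linarith
  have hs : 0 ≤ ‖expSum p t a‖ := norm_nonneg _
  have hst : ‖expSum p t a‖ ≤ t := by
    refine le_of_pow_le_pow_left₀ two_ne_zero ht'.le ?_
    have : 0 ≤ ∑ k ∈ rootsMod p t, deficiency p t (a * (k - 1)) :=
      Finset.sum_nonneg fun _ _ => deficiency_nonneg _
    linarith
  -- Uses t² - |s|² = (t - |s|)(t + |s|) with |s| ≤ t.
  have h4 : ((t : ℝ) - 1) * δ ≤ 2 * t * (t - ‖expSum p t a‖) := by nlinarith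
  have h5 : (1 - 1 / (t : ℝ)) * δ / 2 = ((t : ℝ) - 1) * δ / (2 * t) := by field_simp
  rw [h5, div_le_iff₀ (by positivity)]
  linarith

theorem constLambda_pow_eight : constLambda ^ 8 = 256 / 9 := by
  rw [constLambda, mul_pow, ← Real.rpow_natCast ((3 : ℝ) ^ _), ← Real.rpow_mul (by norm_num),
    show (-(1 / 4 : ℝ)) * ((8 : ℕ) : ℝ) = -(2 : ℕ) by norm_num, Real.rpow_neg (by norm_num),
    Real.rpow_natCast]
  norm_num

/-- Here p^(1-1/n) = p exp(-(log p)/n), and exp x ≥ 1 + x. -/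
theorem self_sub_log_le_rpow {p n d : ℕ} (hp : 0 < p) (hd : 0 < d) (hdn : d ≤ n) :
    (p : ℝ) - p * Real.log p / d ≤ (p : ℝ) ^ (1 - 1 / (n : ℝ)) := by
  have hp' : (0 : ℝ) < p := by exact_mod_cast hp
  have hd' : (0 : ℝ) < d := by exact_mod_cast hd
  have hn' : (0 : ℝ) < n := by exact_mod_cast hd.trans_le hdn
  have hlog : 0 ≤ Real.log p := Real.log_natCast_nonneg p
  have h1 : (p : ℝ) ^ (1 - 1 / (n : ℝ)) = p * Real.exp (-(Real.log p / n)) := by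
    rw [Real.rpow_def_of_pos hp']
    conv_rhs => rw [← Real.exp_log hp']
    rw [← Real.exp_add, Real.log_exp]
    congr 1; ring
  have h2 := Real.add_one_le_exp (-(Real.log p / n))
  have h3 : Real.log p / n ≤ Real.log p / d := by gcongr
  rw [h1]
  have h4 := mul_le_mul_of_nonneg_left h2 hp'.le
  have h5 := mul_le_mul_of_nonneg_left h3 hp'.le
  rw [mul_div_assoc]
  linarith

/-- The exponent arithmetic comparing the two hypotheses. -/
theorem le_rpow_pow_eight {r : ℕ} (hr : 2 ≤ r) {P D Z : ℝ} (hP : 0 < P) (hD : 0 < D)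
    (hZ : P ^ (4 - 2 / (r : ℝ)) * D ^ (2 - 1 / (r : ℝ)) * 2 ^ (1 / (r : ℝ) - 1) ≤ Z) :
    P ^ 6 * D ^ 3 * 2 ^ (-(3 / 2 : ℝ)) ≤ (Z ^ (3 * (r : ℝ) / (16 * (r : ℝ) - 8))) ^ 8 := by
  have hr2 : (2 : ℝ) ≤ r := by exact_mod_cast hr
  have hr0 : (r : ℝ) ≠ 0 := by positivity
  have hr1 : (16 * (r : ℝ) - 8) ≠ 0 := by nlinarith
  have hr1' : 0 < (16 * (r : ℝ) - 8) := by nlinarith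
  have h2r : (2 * (r : ℝ) - 1) ≠ 0 := by nlinarith
  have hbase : 0 ≤ P ^ (4 - 2 / (r : ℝ)) * D ^ (2 - 1 / (r : ℝ)) * 2 ^ (1 / (r : ℝ) - 1) := by
    positivity
  have hZ0 : 0 ≤ Z := hbase.trans hZ
  set e := 3 * (r : ℝ) / (16 * (r : ℝ) - 8) * (8 : ℕ) with he
  have he0 : 0 ≤ e := by positivity
  rw [← Real.rpow_natCast (Z ^ _), ← Real.rpow_mul hZ0]
  refine le_trans ?_ (Real.rpow_le_rpow hbase hZ he0)
  -- The exponent 3r/(2r-1) turns those of P and D into the integers 6 and 3; that of 2 becomes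
  -- -(3r-3)/(2r-1) ≥ -3/2.
  have he' : e = 3 * r / (2 * r - 1) := by
    rw [he, div_mul_eq_mul_div, div_eq_div_iff hr1 h2r]; push_cast; ring
  have q : 2 - 1 / (r : ℝ) = (2 * r - 1) / r := by rw [sub_div, mul_div_cancel_right₀ _ hr0]
  have e2 : (2 - 1 / (r : ℝ)) * e = (3 : ℕ) := by
    rw [he', q, div_mul_div_comm, div_eq_iff (mul_ne_zero hr0 h2r)]; push_cast; ring
  have e1 : (4 - 2 / (r : ℝ)) * e = (6 : ℕ) := by
    push_cast at e2 ⊢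
    linear_combination 2 * e2
  have e3 : -(3 / 2 : ℝ) ≤ (1 / (r : ℝ) - 1) * e := by
    have : (1 / (r : ℝ) - 1) * e = (3 - 3 * r) / (2 * r - 1) := by
      rw [he', eq_div_iff h2r, mul_assoc, div_mul_cancel₀ _ h2r]; field_simp
    rw [this, le_div_iff₀ (by linarith)]
    linarith
  rw [Real.mul_rpow (by positivity) (by positivity), Real.mul_rpow (by positivity) (by positivity),
    ← Real.rpow_mul hP.le, ← Real.rpow_mul hD.le, ← Real.rpow_mul (by norm_num), e1, e2,
    Real.rpow_natCast, Real.rpow_natCast]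
  refine mul_le_mul_of_nonneg_left ?_ (by positivity)
  exact Real.rpow_le_rpow_of_exponent_le (by norm_num) e3

theorem two_rpow_neg_three_halves_gt : (90 / 256 : ℝ) < 2 ^ (-(3 / 2 : ℝ)) := by
  refine lt_of_pow_lt_pow_left₀ 2 (by positivity) ?_
  rw [← Real.rpow_natCast ((2 : ℝ) ^ _), ← Real.rpow_mul (by norm_num),
    show (-(3 / 2 : ℝ)) * ((2 : ℕ) : ℝ) = -(3 : ℕ) by norm_num, Real.rpow_neg (by norm_num),
    Real.rpow_natCast]
  norm_num

/-- The upper bound lets 1 - 1/f_r replace 1 - 1/t in the lattice estimate; the lower one keeps K_r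
positive. -/
theorem leastTotient_bounds {r t : ℕ} (hr : 2 ≤ r) (hrt : r ≤ t.totient) :
    2 ≤ leastTotient r ∧ leastTotient r ≤ t := by
  have hne : {f : ℕ | r ≤ Nat.totient f}.Nonempty := ⟨t, hrt⟩
  refine ⟨?_, Nat.sInf_le hrt⟩
  have h1 : r ≤ Nat.totient (leastTotient r) := Nat.sInf_mem hne
  exact hr.trans (h1.trans (Nat.totient_le _))

theorem norm_gaussS_le {n p r d t : ℕ} [Fact p.Prime] (hn : 1 ≤ n)
    (hd : d = Nat.gcd n (p - 1)) (ht : t = (p - 1) / d)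
    (hr : 2 ≤ r) (hrt : r ≤ Nat.totient t)
    (htbound : (p : ℝ) ^ (2 / (r : ℝ)) * (t : ℝ) ^ (1 - 1 / (r : ℝ)) > 32 * (r : ℝ) * constC r)
    (hpbound : (p : ℝ) ^ (1 - 1 / (n : ℝ)) ≥
      1 + constLambda *
        ((p : ℝ) ^ 5 * Real.log (p : ℝ) /
            (2 * constK r * ((p : ℝ) - 1) ^ (1 / (r : ℝ)))) ^
          (3 * (r : ℝ) / (16 * (r : ℝ) - 8)))
    {a : ℤ} (ha : (a : ZMod p) ≠ 0) :
    ‖gaussS d a p‖ ≤ (p : ℝ) ^ (1 - 1 / (n : ℝ)) := by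
  have hdpos : 0 < d := hd ▸ Nat.gcd_pos_of_pos_left _ hn
  have hdn : d ≤ n := hd ▸ Nat.gcd_le_left _ hn
  have hdt : d * t = p - 1 := by
    rw [ht, Nat.mul_div_cancel' (hd ▸ Nat.gcd_dvd_right _ _)]
  have htpos : 0 < t := Nat.totient_pos.1 (by omega)
  have hp1 : 1 < p := (Fact.out : p.Prime).one_lt
  have hp : (0 : ℝ) < p := by exact_mod_cast (Fact.out : p.Prime).pos
  have ht' : (0 : ℝ) < t := by exact_mod_cast htpos
  have hd' : (0 : ℝ) < d := by exact_mod_cast hdpos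
  have hr0 : (0 : ℝ) < r := by exact_mod_cast (by omega : 0 < r)
  have hdtp : (d : ℝ) * t = p - 1 := by
    rw [← Nat.cast_mul, hdt, Nat.cast_sub hp1.le, Nat.cast_one]
  have hcard := (rootsMod_card_and_fibre hdpos htpos hdt).1
  obtain ⟨g, hg⟩ := exists_orderOf_eq hdpos hdt
  have hC := constC_pos hr
  obtain ⟨hf2, hft⟩ := leastTotient_bounds hr hrt
  have hf2' : (2 : ℝ) ≤ leastTotient r := by exact_mod_cast hf2
  have hft' : (leastTotient r : ℝ) ≤ t := by exact_mod_cast hft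
  have hf : 0 < 1 - 1 / (leastTotient r : ℝ) := by
    rw [sub_pos, div_lt_one (by linarith)]; linarith
  have hK : 0 < constK r := by unfold constK; positivity
  have hgeo := le_sub_norm_expSum htpos hcard ha
    (fun b hb => le_deficiency htpos hcard hg hb hr hrt htbound)
  have henergy := norm_expSum_pow_eight_mul_le hdpos htpos hdt ha
  set s := ‖expSum p t a‖ with hs
  have hs0 : 0 ≤ s := norm_nonneg _
  have hG : ‖gaussS d a p‖ ≤ 1 + d * s := by
    rw [gaussS_eq hdpos htpos hdt]
    refine (norm_add_le _ _).trans ?_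
    rw [norm_one, norm_mul, Complex.norm_natCast]
  refine hG.trans ?_
  by_contra hcon
  push Not at hcon
  set Pr := (p : ℝ) ^ (2 / (r : ℝ)) with hPr
  set Tr := (t : ℝ) ^ (1 / (r : ℝ)) with hTr
  set R2 := (2 : ℝ) ^ (1 / (r : ℝ)) with hR2
  have hPr0 : 0 < Pr := by positivity
  have hTr0 : 0 < Tr := by positivity
  have hR20 : 0 < R2 := by positivity
  -- the two bounds force `d` to be small in terms of `p`
  have h1 : constK r * R2 * Tr / Pr ≤ t - s := by
    refine le_trans ?_ hgeo
    have h2 : 1 - 1 / (leastTotient r : ℝ) ≤ 1 - 1 / (t : ℝ) := by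
      have : 1 / (t : ℝ) ≤ 1 / (leastTotient r : ℝ) := by gcongr
      linarith
    calc constK r * R2 * Tr / Pr =
          (1 - 1 / (leastTotient r : ℝ)) * (8 * R2 * constC r * Tr / Pr) / 2 := by
          rw [constK]; ring
      _ ≤ _ := by gcongr
  have h2 : (d : ℝ) * (t - s) < p * Real.log p / d := by
    have := self_sub_log_le_rpow (Fact.out : p.Prime).pos hdpos hdn
    linarith
  have h3 : (d : ℝ) ^ 2 * (constK r * R2 * Tr / Pr) < p * Real.log p := by
    have h4 := mul_le_mul_of_nonneg_left h1 hd'.le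
    have h5 := h4.trans_lt h2
    rw [lt_div_iff₀ hd'] at h5
    linarith
  set Z := (p : ℝ) ^ 5 * Real.log (p : ℝ) / (2 * constK r * ((p : ℝ) - 1) ^ (1 / (r : ℝ))) with hZ
  -- Since (p-1)^(1/r) = d^(1/r) t^(1/r), the factors K_r and t^(1/r) cancel and only p and d
  -- remain.
  have hZle : (p : ℝ) ^ (4 - 2 / (r : ℝ)) * (d : ℝ) ^ (2 - 1 / (r : ℝ)) *
      2 ^ (1 / (r : ℝ) - 1) ≤ Z := by
    have e1 : (p : ℝ) ^ (4 - 2 / (r : ℝ)) = p ^ 4 / Pr := by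
      rw [Real.rpow_sub hp, ← hPr]; congr 1; exact_mod_cast Real.rpow_natCast (p : ℝ) 4
    have e2 : (d : ℝ) ^ (2 - 1 / (r : ℝ)) = d ^ 2 / (d : ℝ) ^ (1 / (r : ℝ)) := by
      rw [Real.rpow_sub hd', Real.rpow_two]
    have e3 : (2 : ℝ) ^ (1 / (r : ℝ) - 1) = R2 / 2 := by
      rw [Real.rpow_sub (by norm_num), Real.rpow_one]
    have e4 : ((p : ℝ) - 1) ^ (1 / (r : ℝ)) = (d : ℝ) ^ (1 / (r : ℝ)) * Tr := by
      rw [← hdtp, Real.mul_rpow hd'.le ht'.le]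
    have hDr0 : 0 < (d : ℝ) ^ (1 / (r : ℝ)) := by positivity
    rw [hZ, e1, e2, e3, e4, le_div_iff₀ (by positivity)]
    have h6 := mul_le_mul_of_nonneg_left h3.le (by positivity : 0 ≤ (p : ℝ) ^ 4)
    refine le_trans (le_of_eq ?_) (h6.trans (le_of_eq ?_))
    · field_simp
    · ring
  have h8 := le_rpow_pow_eight hr hp hd' hZle
  set Y := Z ^ (3 * (r : ℝ) / (16 * (r : ℝ) - 8)) with hY
  have hZ0 : 0 ≤ Z := le_trans (by positivity) hZle
  have hY0 : 0 ≤ Y := Real.rpow_nonneg hZ0 _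
  have hlam : 0 < constLambda := by unfold constLambda; positivity
  have h9 : constLambda * Y < d * s := by linarith
  have h10 : (constLambda * Y) ^ 8 < (d * s) ^ 8 :=
    pow_lt_pow_left₀ h9 (by positivity) (by norm_num)
  rw [mul_pow, mul_pow, constLambda_pow_eight] at h10
  -- The constants meet here: λ^8 = 256/9 and 2^(-3/2) > 90/256, so their product exceeds 10.
  have h11 : 10 * (p : ℝ) ^ 6 * (d : ℝ) ^ 3 < (d : ℝ) ^ 8 * s ^ 8 := by
    refine lt_trans ?_ (lt_of_le_of_lt (mul_le_mul_of_nonneg_left h8 (by norm_num)) h10)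
    have h12 : 0 < (p : ℝ) ^ 6 * (d : ℝ) ^ 3 := by positivity
    have := mul_lt_mul_of_pos_left two_rpow_neg_three_halves_gt h12
    linarith
  have h12 := mul_le_mul_of_nonneg_right henergy (by positivity : 0 ≤ (d : ℝ) ^ 3)
  have h13 : (d : ℝ) ^ 5 * s ^ 8 * (d : ℝ) ^ 3 = (d : ℝ) ^ 8 * s ^ 8 := by ring
  linarith

theorem proposition2 (n p r d t : ℕ) (hn : 1 ≤ n) (hp : p.Prime)
    (hd : d = Nat.gcd n (p - 1)) (ht : t = (p - 1) / d)
    (hr : 2 ≤ r) (hrt : r ≤ Nat.totient t)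
    (htbound : (p : ℝ) ^ (2 / (r : ℝ)) * (t : ℝ) ^ (1 - 1 / (r : ℝ)) > 32 * (r : ℝ) * constC r)
    (hpbound : (p : ℝ) ^ (1 - 1 / (n : ℝ)) ≥
      1 + constLambda *
        ((p : ℝ) ^ 5 * Real.log (p : ℝ) /
            (2 * constK r * ((p : ℝ) - 1) ^ (1 / (r : ℝ)))) ^
          (3 * (r : ℝ) / (16 * (r : ℝ) - 8))) :
    gaussG d p ≤ (p : ℝ) ^ (1 - 1 / (n : ℝ)) := by
  have := Fact.mk hp
  refine csSup_le ⟨_, 1, by simp, rfl⟩ ?_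
  rintro v ⟨a, ha, rfl⟩
  refine norm_gaussS_le hn hd ht hr hrt htbound hpbound ?_
  intro h0
  have h1 : (p : ℤ) ∣ Int.gcd a p :=
    Int.dvd_coe_gcd ((ZMod.intCast_zmod_eq_zero_iff_dvd a p).1 h0) dvd_rfl
  rw [ha] at h1
  exact hp.one_lt.ne' (by exact_mod_cast Int.eq_one_of_dvd_one (by positivity) h1)
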